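/- Work over $\mathbb{C}$. A smooth rational curve of degree $d$ in $\mathbb{P}^n$ is a curve $C\subset\mathbb{P}^n$ which is the image of a closed embedding $\mathbb{P}^1\hookrightarrow\mathbb{P}^n$ given by $n+1$ binary forms of degree $d$ without common zeros; it is nondegenerate if no hyperplane contains it. A line $L\subset\mathbb{P}^n$ is a $k$-secant line of $C$ if there is an effective divisor $D=q_1+\dots+q_k$ of degree $k$ on $C$ (the points $q_i$ need not be distinct) which is contained in $L$ as a subscheme, i.e. if the scheme $L\cap C$ has length at least $k$. (1) If $C\subset\mathbb{P}^4$ is a smooth nondegenerate rational curve of degree $5$, then $C$ has a unique $3$-secant line $L\subset\mathbb{P}^4$, and $L$ is not a $4$-secant line of $C$. (2) If $C\subset\mathbb{P}^3$ is a smooth rational curve of degree $5$, then $C$ has a one-parameter family of $3$-secant lines: the set of $3$-secant lines of $C$ is an irreducible Zariski closed subset of dimension $1$ of the Grassmannian of lines in $\mathbb{P}^3$. (3) If $C\subset\mathbb{P}^3$ is a smooth rational curve of degree $5$ and every $3$-secant line of $C$ is a $4$-secant line of $C$, then $C$ lies on a smooth quadric surface $Q\subset\mathbb{P}^3$ as a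 divisor of type $(1,4)$; that is, for a suitable isomorphism $\mathbb{P}^1\times\mathbb{P}^1\cong Q$ given by the two rulings, $C$ is the zero divisor of a bihomogeneous form of bidegree $(1,4)$. -/

import Mathlib

open MvPolynomial
open scoped LinearAlgebra.Projectivization

noncomputable section

/-- The complex projective space `ℙⁿ` of lines through the origin in `ℂⁿ⁺¹`. -/
abbrev PSpace (n : ℕ) : Type := ℙ ℂ (Fin (n + 1) → ℂ)

/-- The value at `x ∈ ℂ²` of an `(n+1)`-tuple of binary forms. -/
def evalForms {n : ℕ} (φ : Fin (n + 1) → MvPolynomial (Fin 2) ℂ) (x : Fin 2 → ℂ) :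
    Fin (n + 1) → ℂ :=
  fun i => eval x (φ i)

theorem evalForms_smul {n d : ℕ} {φ : Fin (n + 1) → MvPolynomial (Fin 2) ℂ}
    (h : ∀ i, (φ i).IsHomogeneous d) (t : ℂ) (x : Fin 2 → ℂ) :
    evalForms φ (t • x) = t ^ d • evalForms φ x := by
  funext i
  simp only [evalForms, Pi.smul_apply, smul_eq_mul, eval_eq', Finset.mul_sum]
  refine Finset.sum_congr rfl fun m hm => ?_
  have hd := h i (mem_support_iff.mp hm)
  rw [Finsupp.weight_apply, Finsupp.sum_fintype _ _ (by simp)] at hd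
  simp only [Pi.one_apply, smul_eq_mul, mul_one] at hd
  rw [← hd]
  simp only [mul_pow, Finset.prod_mul_distrib, Finset.prod_pow_eq_pow_sum]
  ring

/-- A morphism `ℙ¹ → ℙⁿ` of degree `d`, that is, one which pulls `𝒪(1)` back to `𝒪(d)`: it is
given by `n + 1` binary forms of degree `d` without a common zero on `ℙ¹`. -/
structure ProjLineMorphism (n d : ℕ) where
  /-- the coordinate forms -/
  form : Fin (n + 1) → MvPolynomial (Fin 2) ℂ
  homogeneous : ∀ i, (form i).IsHomogeneous d
  base_point_free : ∀ x : Fin 2 → ℂ, x ≠ 0 → evalForms form x ≠ 0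

/-- The map on points of a morphism `ℙ¹ → ℙⁿ`, `[x] ↦ [φ₀(x) : … : φₙ(x)]`. -/
def ProjLineMorphism.onPoints {n d : ℕ} (φ : ProjLineMorphism n d) : PSpace 1 → PSpace n :=
  Projectivization.lift
    (fun x : {v : Fin 2 → ℂ // v ≠ 0} =>
      Projectivization.mk ℂ (evalForms φ.form x.1) (φ.base_point_free x.1 x.2))
    (by
      rintro ⟨a, ha⟩ ⟨b, hb⟩ t hab
      have hab' : a = t • b := hab
      refine (Projectivization.mk_eq_mk_iff' ℂ _ _ _ _).2 ⟨t ^ d, ?_⟩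
      change t ^ d • evalForms φ.form b = evalForms φ.form a
      rw [hab', evalForms_smul φ.homogeneous])

/-- A smooth rational curve of degree `d` in `ℙⁿ`, given by a closed embedding `ℙ¹ ↪ ℙⁿ`
of degree `d`: a morphism which is injective on points and on tangent vectors.

By Euler's relation the differential of `[φ₀ : … : φₙ]` is injective at `[x]` if and only if the
two vectors `∂φ/∂x₀ (x)` and `∂φ/∂x₁ (x)` of `ℂⁿ⁺¹` are linearly independent. -/
structure SmoothRationalCurve (n d : ℕ) extends ProjLineMorphism n d where
  injective : Function.Injective toProjLineMorphism.onPoints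
  immersion : ∀ x : Fin 2 → ℂ, x ≠ 0 →
    LinearIndependent ℂ fun j : Fin 2 => evalForms (fun i => pderiv j (form i)) x

/-- Lines in `ℙⁿ`, that is, the points of the Grassmannian of two-dimensional linear subspaces
of `ℂⁿ⁺¹`. -/
def LineIn (n : ℕ) : Type :=
  {W : Submodule ℂ (Fin (n + 1) → ℂ) // Module.finrank ℂ W = 2}

namespace LineIn

/-- The Plücker coordinates `vᵢ wⱼ - vⱼ wᵢ` of the line spanned by `v` and `w`. -/
def pluecker {n : ℕ} (v w : Fin (n + 1) → ℂ) : Fin (n + 1) × Fin (n + 1) → ℂ :=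
  fun p => v p.1 * w p.2 - v p.2 * w p.1

/-- The homogeneous polynomial `F` vanishes at the Plücker coordinates of the line `L`. -/
def Vanishes {n : ℕ} (F : MvPolynomial (Fin (n + 1) × Fin (n + 1)) ℂ) (L : LineIn n) : Prop :=
  ∀ v ∈ L.1, ∀ w ∈ L.1, LinearIndependent ℂ ![v, w] → eval (pluecker v w) F = 0

/-- The Zariski topology of the Grassmannian in its Plücker embedding: the sets where one
homogeneous polynomial in the Plücker coordinates does not vanish are a basis of it. -/
instance zariskiTopology (n : ℕ) : TopologicalSpace (LineIn n) :=
  TopologicalSpace.generateFrom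
    {U | ∃ (F : MvPolynomial (Fin (n + 1) × Fin (n + 1)) ℂ) (e : ℕ),
      F.IsHomogeneous e ∧ U = {L | ¬ Vanishes F L}}

end LineIn

namespace SmoothRationalCurve

variable {n d : ℕ}

/-- The set of points of the curve. -/
def points (C : SmoothRationalCurve n d) : Set (PSpace n) :=
  Set.range C.toProjLineMorphism.onPoints

/-- The curve is not contained in a hyperplane. -/
def Nondegenerate (C : SmoothRationalCurve n d) : Prop :=
  ∀ ℓ : Module.Dual ℂ (Fin (n + 1) → ℂ), ℓ ≠ 0 → ∃ P ∈ C.points, ℓ P.rep ≠ 0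

/-- The restriction to `C ≅ ℙ¹` of a linear form on `ℙⁿ`, a binary form of degree `d`. -/
def restrict (C : SmoothRationalCurve n d) (ℓ : Module.Dual ℂ (Fin (n + 1) → ℂ)) :
    MvPolynomial (Fin 2) ℂ :=
  ∑ i, MvPolynomial.C (ℓ (Pi.single i 1)) * C.form i

/-- `L` is a `k`-secant line of `C`: there is an effective divisor `D` of degree `k` on `C` which
is contained, as a subscheme, in `L`; that is, the scheme `L ∩ C` has length at least `k`.
The effective divisors of degree `k` on `C ≅ ℙ¹` are the zero divisors of the nonzero binary forms
`g` of degree `k`, and `D` is contained in `L` if and only if the restriction to `C` of each linear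
form which vanishes on `L` is divisible by `g`. -/
def IsSecant (C : SmoothRationalCurve n d) (k : ℕ) (L : LineIn n) : Prop :=
  ∃ g : MvPolynomial (Fin 2) ℂ, g ≠ 0 ∧ g.IsHomogeneous k ∧
    ∀ ℓ ∈ L.1.dualAnnihilator, g ∣ C.restrict ℓ

/-- The set of `k`-secant lines of `C`, a subset of the Grassmannian of lines. -/
def secantLines (C : SmoothRationalCurve n d) (k : ℕ) : Set (LineIn n) :=
  {L | C.IsSecant k L}

end SmoothRationalCurve

/-- `q` is the equation of a smooth quadric surface in `ℙ³` (Jacobian criterion). -/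
def IsSmoothQuadric (q : MvPolynomial (Fin 4) ℂ) : Prop :=
  q.IsHomogeneous 2 ∧
    ∀ x : Fin 4 → ℂ, x ≠ 0 → eval x q = 0 → ∃ i, eval x (pderiv i q) ≠ 0

/-- The linear isomorphism `A` carries the Segre surface, the quadric of the `2 × 2` matrices of
determinant zero, to the quadric surface `q = 0`. Then `([x], [y]) ↦ [A (x yᵀ)]` is an isomorphism
from `ℙ¹ × ℙ¹` to the quadric, and the images of the two families of fibres are its rulings. -/
def IsSegreCoordinates (q : MvPolynomial (Fin 4) ℂ)
    (A : Matrix (Fin 2) (Fin 2) ℂ ≃ₗ[ℂ] (Fin 4 → ℂ)) : Prop :=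
  ∀ M : Matrix (Fin 2) (Fin 2) ℂ, eval (A M) q = 0 ↔ M.det = 0

/-- `F(x, y)` is bihomogeneous, of degree `a` in `x = (x₀, x₁)` and `b` in `y = (y₀, y₁)`. -/
def IsBihomogeneous (F : MvPolynomial (Fin 2 ⊕ Fin 2) ℂ) (a b : ℕ) : Prop :=
  F.IsWeightedHomogeneous (Sum.elim (fun _ => 1) (fun _ => 0) : Fin 2 ⊕ Fin 2 → ℕ) a ∧
  F.IsWeightedHomogeneous (Sum.elim (fun _ => 0) (fun _ => 1) : Fin 2 ⊕ Fin 2 → ℕ) b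

/-- The reduced curve with point set `S` lies on the smooth quadric surface `q = 0` in `ℙ³` as a
divisor of type `(a, b)`, for a suitable ordering of the two rulings: under an isomorphism of
`ℙ¹ × ℙ¹` with the quadric it is the zero divisor of a bihomogeneous form of bidegree `(a, b)`.
The form is squarefree, so that its zero divisor is reduced. -/
def IsDivisorOfType (q : MvPolynomial (Fin 4) ℂ) (S : Set (PSpace 3)) (a b : ℕ) : Prop :=
  (∀ P ∈ S, eval P.rep q = 0) ∧
  ∃ A : Matrix (Fin 2) (Fin 2) ℂ ≃ₗ[ℂ] (Fin 4 → ℂ), IsSegreCoordinates q A ∧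
    ∃ F : MvPolynomial (Fin 2 ⊕ Fin 2) ℂ, IsBihomogeneous F a b ∧ Squarefree F ∧
      ∀ (x y : Fin 2 → ℂ) (_ : x ≠ 0) (_ : y ≠ 0)
        (h : A (Matrix.vecMulVec x y) ≠ 0),
        eval (Sum.elim x y) F = 0 ↔ Projectivization.mk ℂ (A (Matrix.vecMulVec x y)) h ∈ S

end

/-! Let `V = Fin 6 → ℂ` be the space of functionals on binary quintics. The points `evalVec x` trace
the rational normal quintic in `ℙ(V) = ℙ⁵`, and the given curve is its linear projection by
`spanMap`, with centre `K = ker spanMap`. For a form `g` of degree `k ≤ 5`, `annihilator m g` (`k +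
m = 5`) is the linear span of the divisor `g = 0` on the rational normal quintic, of vector space
dimension `k`. A line `L` is `k`-secant exactly when it contains the projection of such a span
(`isSecant_iff`), and the projection of an embedded curve has a centre `K` which meets no secant or
tangent line (`isSeparating_ker_spanMap`).

By Sylvester's argument, the `3 × 4` Hankel matrix of a nonzero `ν ∈ K` has rank three, so exactly
one cubic `g` up to scalars kills `ν`. The plane spanned by `g` meets `ℙ(K)` in the point `[ν]`
alone and projects to a line. Hence the trisecant lines are the projections of these planes, one for
each point of `ℙ(K)` (`isSecant_three_iff`). A four-secant line needs a span of vector space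
dimension four to drop to dimension two, hence `dim K ≥ 2`.

In `ℙ⁴`, nondegeneracy gives `dim K = 1`: one trisecant line, not four-secant.

In `ℙ³`, `dim K = 2`, because a smooth rational quintic is not a plane curve (`finrank_le_two`):
otherwise the pencil of quartics residual to a moving point of the curve would never have a base
point, while its resultant is a form of positive degree in that point and has a zero. The trisecant
lines are then parametrized by the line `ℙ(K)`. Locally the parametrization is polynomial, so an
equation valid at infinitely many trisecants is valid at all (`vanishes_of_infinite`). Infinitely
many lines occur (`infinite_secantLines`), so the topology on their set has only finite proper
closed subsets, which gives irreducibility and dimension one. Closedness comes from a determinantal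
criterion for two quintics to share a cubic factor (`isSecant_three_iff_vanishes`).

If all trisecants are four-secant, two of them give quartics `G₀`, `G₁` whose spans contain `K`. The
products `Gⱼ xₖ` are then a basis of the restrictions of linear forms (`pencilForm_injective`), so
in suitable coordinates the curve is `s ↦ G(s) sᵀ` on the Segre quadric: the graph `x₀ G₁(y) = x₁
G₀(y)`, of type `(1, 4)`. -/

noncomputable section

/-! ### Binary forms and their coefficient vectors -/

/-- The binary form `∑ⱼ aⱼ x₀ʲ x₁ᵈ⁻ʲ` with coefficient vector `a`. -/
def binaryForm (d : ℕ) (a : Fin (d + 1) → ℂ) : MvPolynomial (Fin 2) ℂ :=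
  ∑ j, C (a j) * (X 0 ^ (j : ℕ) * X 1 ^ (d - j))

/-- The exponent of `x₀ʲ x₁ⁿ`. -/
def binaryExponent (j n : ℕ) : Fin 2 →₀ ℕ := Finsupp.single 0 j + Finsupp.single 1 n

theorem X_pow_mul_X_pow_eq_monomial (j n : ℕ) :
    (X 0 ^ j * X 1 ^ n : MvPolynomial (Fin 2) ℂ) = monomial (binaryExponent j n) 1 := by
  rw [X_pow_eq_monomial, X_pow_eq_monomial, monomial_mul, one_mul, binaryExponent]

theorem binaryExponent_inj {j n j' n' : ℕ} :
    binaryExponent j n = binaryExponent j' n' ↔ j = j' ∧ n = n' := by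
  constructor
  · intro h
    have h0 := DFunLike.congr_fun h 0
    have h1 := DFunLike.congr_fun h 1
    simp [binaryExponent] at h0 h1
    exact ⟨h0, h1⟩
  · rintro ⟨rfl, rfl⟩; rfl

theorem eq_binaryExponent (m : Fin 2 →₀ ℕ) : m = binaryExponent (m 0) (m 1) := by
  ext i
  fin_cases i <;> simp [binaryExponent]

theorem coeff_binaryForm {d : ℕ} (a : Fin (d + 1) → ℂ) (j : Fin (d + 1)) :
    coeff (binaryExponent j (d - j)) (binaryForm d a) = a j := by
  simp only [binaryForm, coeff_sum, X_pow_mul_X_pow_eq_monomial, coeff_C_mul, coeff_monomial,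
    binaryExponent_inj]
  rw [Finset.sum_eq_single j]
  · simp
  · intro b _ hb
    rw [if_neg]
    · simp
    · rintro ⟨h, -⟩
      exact hb (Fin.ext h)
  · simp

theorem binaryForm_injective (d : ℕ) : Function.Injective (binaryForm d) := by
  intro a b h
  funext j
  rw [← coeff_binaryForm a, h, coeff_binaryForm]

@[simp] theorem binaryForm_zero (d : ℕ) : binaryForm d 0 = 0 := by simp [binaryForm]

theorem binaryForm_eq_zero_iff {d : ℕ} {a : Fin (d + 1) → ℂ} : binaryForm d a = 0 ↔ a = 0 := by
  rw [← binaryForm_zero d, (binaryForm_injective d).eq_iff]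

theorem binaryForm_add {d : ℕ} (a b : Fin (d + 1) → ℂ) :
    binaryForm d (a + b) = binaryForm d a + binaryForm d b := by
  simp [binaryForm, add_mul, Finset.sum_add_distrib]

theorem binaryForm_smul {d : ℕ} (t : ℂ) (a : Fin (d + 1) → ℂ) :
    binaryForm d (t • a) = C t * binaryForm d a := by
  simp [binaryForm, Finset.mul_sum, mul_assoc]

theorem binaryForm_isHomogeneous {d : ℕ} (a : Fin (d + 1) → ℂ) :
    (binaryForm d a).IsHomogeneous d := by
  refine IsHomogeneous.sum _ _ _ fun j _ => ?_
  rw [X_pow_mul_X_pow_eq_monomial]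
  refine (isHomogeneous_monomial _ ?_).C_mul _
  have := j.2
  simp only [binaryExponent, map_add, Finsupp.degree_single]
  omega

theorem MvPolynomial.IsHomogeneous.exists_eq_binaryForm {d : ℕ} {f : MvPolynomial (Fin 2) ℂ}
    (hf : f.IsHomogeneous d) : ∃ a, f = binaryForm d a := by
  refine ⟨fun j => coeff (binaryExponent j (d - j)) f, ?_⟩
  ext m
  by_cases hm : m.degree = d
  · have h2 : m 0 + m 1 = d := by
      rw [← hm, Finsupp.degree_eq_sum, Fin.sum_univ_two]
    have hm' : m = binaryExponent ((⟨m 0, by omega⟩ : Fin (d + 1)) : ℕ)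
        (d - (⟨m 0, by omega⟩ : Fin (d + 1))) := by
      conv_lhs => rw [eq_binaryExponent m]
      rw [binaryExponent_inj]
      constructor
      · rfl
      · simp; omega
    rw [hm', coeff_binaryForm]
  · rw [hf.coeff_eq_zero hm, (binaryForm_isHomogeneous _).coeff_eq_zero hm]

theorem eval_binaryForm {d : ℕ} (a : Fin (d + 1) → ℂ) (x : Fin 2 → ℂ) :
    eval x (binaryForm d a) = ∑ j, a j * (x 0 ^ (j : ℕ) * x 1 ^ (d - j)) := by
  simp [binaryForm]

theorem binaryForm_mul {k m : ℕ} (g : Fin (k + 1) → ℂ) (h : Fin (m + 1) → ℂ) :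
    binaryForm k g * binaryForm m h =
      ∑ j, ∑ i, C (g j * h i) * (X 0 ^ ((i : ℕ) + j) * X 1 ^ (k + m - (i + j))) := by
  simp only [binaryForm, Finset.sum_mul_sum]
  refine Finset.sum_congr rfl fun j _ => Finset.sum_congr rfl fun i _ => ?_
  have hj := j.2
  have hi := i.2
  rw [show k + m - ((i : ℕ) + j) = (k - j) + (m - i) by omega, C_mul, pow_add, pow_add]
  ring

/-- A quotient of homogeneous polynomials is homogeneous. -/
theorem MvPolynomial.IsHomogeneous.exists_eq_mul_of_dvd {σ : Type*} {k m : ℕ}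
    {f g : MvPolynomial σ ℂ} (hf : f.IsHomogeneous (k + m)) (hg : g.IsHomogeneous k)
    (h : g ∣ f) : ∃ q, q.IsHomogeneous m ∧ f = g * q := by
  classical
  obtain ⟨q, rfl⟩ := h
  -- In `g * q`, only the degree `m` part of `q` contributes to degree `k + m`.
  refine ⟨homogeneousComponent m q, homogeneousComponent_isHomogeneous _ _, ?_⟩
  have h1 : homogeneousComponent (k + m) (g * q) = g * q := homogeneousComponent_eq_self hf
  rw [← h1]
  conv_lhs => rw [← sum_homogeneousComponent q]
  rw [Finset.mul_sum, map_sum]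
  by_cases hm : m ∈ Finset.range (q.totalDegree + 1)
  · rw [Finset.sum_eq_single m]
    · exact homogeneousComponent_eq_self (hg.mul (homogeneousComponent_isHomogeneous _ _))
    · intro i _ hi
      rw [homogeneousComponent_of_mem (hg.mul (homogeneousComponent_isHomogeneous _ _)),
        if_neg (by omega)]
    · exact fun h => absurd hm h
  · rw [homogeneousComponent_eq_zero (n := m) q (by simpa using hm), mul_zero]
    refine Finset.sum_eq_zero fun i hi => ?_
    rw [homogeneousComponent_of_mem (hg.mul (homogeneousComponent_isHomogeneous _ _)),
      if_neg]
    rintro h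
    exact hm ((by omega : m = i) ▸ hi)

/-- The linear form vanishing at `[x]`. -/
def linForm (x : Fin 2 → ℂ) : MvPolynomial (Fin 2) ℂ := C (x 1) * X 0 - C (x 0) * X 1

theorem linForm_isHomogeneous (x : Fin 2 → ℂ) : (linForm x).IsHomogeneous 1 :=
  (isHomogeneous_C_mul_X _ _).sub (isHomogeneous_C_mul_X _ _)

theorem eval_linForm (x y : Fin 2 → ℂ) : eval y (linForm x) = x 1 * y 0 - x 0 * y 1 := by
  simp [linForm]

theorem binaryForm_one (a : Fin 2 → ℂ) : binaryForm 1 a = linForm ![-a 0, a 1] := by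
  simp [binaryForm, linForm, Fin.sum_univ_two]; ring

theorem linForm_ne_zero {x : Fin 2 → ℂ} (hx : x ≠ 0) : linForm x ≠ 0 := by
  intro h
  apply hx
  have h0 : eval ![1, 0] (linForm x) = 0 := by rw [h]; simp
  have h1 : eval ![0, 1] (linForm x) = 0 := by rw [h]; simp
  simp [eval_linForm] at h0 h1
  ext i
  fin_cases i <;> simp [h0, h1]

/-- Modulo `linForm x` the vector `(X 0, X 1)` becomes proportional to `x`, so by homogeneity the
class of `f` is, up to a unit, a multiple of the value of `f` at `x`. -/
theorem linForm_dvd {d : ℕ} {f : MvPolynomial (Fin 2) ℂ} (hf : f.IsHomogeneous d)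
    {x : Fin 2 → ℂ} (hx : x ≠ 0) (h : eval x f = 0) : linForm x ∣ f := by
  obtain ⟨a, rfl⟩ := hf.exists_eq_binaryForm
  rw [← Ideal.mem_span_singleton, ← Ideal.Quotient.eq_zero_iff_mem]
  set π := Ideal.Quotient.mk (Ideal.span {linForm x}) with hπ
  have hl : π (C (x 1)) * π (X 0) = π (C (x 0)) * π (X 1) := by
    rw [← sub_eq_zero, ← map_mul, ← map_mul, ← map_sub]
    exact Ideal.Quotient.eq_zero_iff_mem.2 (Ideal.mem_span_singleton_self _)
  rw [eval_binaryForm] at h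
  have hu : ∀ z : ℂ, z ≠ 0 → π (C z⁻¹) * π (C z) = 1 := fun z hz => by
    rw [← map_mul, ← C_mul, inv_mul_cancel₀ hz, C_1, map_one]
  -- In the quotient `z (X 0, X 1) = w x`, hence `zᵈ f = wᵈ f(x) = 0`. A nonzero coordinate of `x`
  -- serves as `z`, with the corresponding variable as `w`.
  have key : ∀ (z : ℂ) (w : MvPolynomial (Fin 2) ℂ), z ≠ 0 → π (C z) * π (X 0) = π (C (x 0)) * π w →
      π (C z) * π (X 1) = π (C (x 1)) * π w → π (binaryForm d a) = 0 := by
    intro z w hz h0 h1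
    have : π (C z) ^ d * π (binaryForm d a) = 0 := by
      have e : π (C z) ^ d * π (binaryForm d a) =
          π (C (∑ j, a j * (x 0 ^ (j : ℕ) * x 1 ^ (d - j)))) * π w ^ d := by
        simp only [binaryForm, map_sum, map_mul, map_pow, Finset.mul_sum, Finset.sum_mul]
        refine Finset.sum_congr rfl fun j _ => ?_
        have hj : d = j + (d - j) := by have := j.2; omega
        calc _ = π (C (a j)) * ((π (C z) * π (X 0)) ^ (j : ℕ) *
              (π (C z) * π (X 1)) ^ (d - j)) := by
              conv_lhs => rw [show π (C z) ^ d = π (C z) ^ (j : ℕ) * π (C z) ^ (d - j) by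
                rw [← pow_add, ← hj]]
              ring
          _ = _ := by
              rw [h0, h1]
              conv_rhs => rw [show π w ^ d = π w ^ (j : ℕ) * π w ^ (d - j) by
                rw [← pow_add, ← hj]]
              ring
      rw [e, h]; simp
    calc π (binaryForm d a) = (π (C z⁻¹) * π (C z)) ^ d * π (binaryForm d a) := by
          rw [hu z hz]; simp
      _ = π (C z⁻¹) ^ d * (π (C z) ^ d * π (binaryForm d a)) := by ring
      _ = 0 := by rw [this, mul_zero]
  by_cases h1 : x 1 = 0
  · have h0 : x 0 ≠ 0 := fun h0 => hx (by ext i; fin_cases i <;> simp [h0, h1])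
    refine key (x 0) (X 0) h0 rfl ?_
    rw [hl]
  · exact key (x 1) (X 1) h1 hl rfl

theorem exists_eq_linForm_mul {d : ℕ} {f : MvPolynomial (Fin 2) ℂ} (hf : f.IsHomogeneous (d + 1))
    {x : Fin 2 → ℂ} (hx : x ≠ 0) (h : eval x f = 0) :
    ∃ g, g.IsHomogeneous d ∧ f = linForm x * g := by
  rw [add_comm] at hf
  exact hf.exists_eq_mul_of_dvd (linForm_isHomogeneous x) (linForm_dvd hf hx h)

theorem exists_root_of_isHomogeneous {d : ℕ} {f : MvPolynomial (Fin 2) ℂ}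
    (hf : f.IsHomogeneous (d + 1)) : ∃ x : Fin 2 → ℂ, x ≠ 0 ∧ eval x f = 0 := by
  obtain ⟨a, rfl⟩ := hf.exists_eq_binaryForm
  by_cases ha : a (Fin.last _) = 0
  -- If the coefficient of `x₀ᵈ⁺¹` is zero, the point at infinity is a root; otherwise the
  -- dehomogenized polynomial has full degree and a root by algebraic closedness.
  · refine ⟨![1, 0], fun h => by simpa using congrFun h 0, ?_⟩
    rw [eval_binaryForm, Fin.sum_univ_castSucc]
    simp only [ha, zero_mul, add_zero]
    refine Finset.sum_eq_zero fun j _ => ?_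
    have hj : ¬ d + 1 - (j : ℕ) = 0 := by have := j.2; omega
    simp [hj]
  · set p : Polynomial ℂ := ∑ j, Polynomial.C (a j) * Polynomial.X ^ (j : ℕ) with hp
    have hdeg : p.degree ≠ 0 := by
      intro h0
      have hc : p.coeff (d + 1) = a (Fin.last _) := by
        rw [hp, Polynomial.finsetSum_coeff, Finset.sum_eq_single (Fin.last _)]
        · simp
        · intro j _ hj
          rw [Polynomial.coeff_C_mul, Polynomial.coeff_X_pow, if_neg, mul_zero]
          intro h
          exact hj (Fin.ext (by simp [← h]))
        · simp
      rw [Polynomial.eq_C_of_degree_eq_zero h0, Polynomial.coeff_C, if_neg (by omega)] at hc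
      exact ha hc.symm
    obtain ⟨r, hr⟩ := IsAlgClosed.exists_root p hdeg
    refine ⟨![r, 1], fun h => by simpa using congrFun h 1, ?_⟩
    rw [eval_binaryForm]
    simpa [hp, Polynomial.IsRoot, Polynomial.eval_finsetSum] using hr

theorem exists_eq_linForm_mul_of_isHomogeneous {d : ℕ} {f : MvPolynomial (Fin 2) ℂ}
    (hf : f.IsHomogeneous (d + 1)) :
    ∃ x : Fin 2 → ℂ, x ≠ 0 ∧ ∃ g, g.IsHomogeneous d ∧ f = linForm x * g := by
  obtain ⟨x, hx, h⟩ := exists_root_of_isHomogeneous hf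
  exact ⟨x, hx, exists_eq_linForm_mul hf hx h⟩

theorem exists_smul_eq_of_eval_linForm_eq_zero {x y : Fin 2 → ℂ} (hx : x ≠ 0)
    (h : eval y (linForm x) = 0) : ∃ t : ℂ, y = t • x := by
  rw [eval_linForm] at h
  by_cases h1 : x 1 = 0
  · have h0 : x 0 ≠ 0 := fun h0 => hx (by ext i; fin_cases i <;> simp [h0, h1])
    refine ⟨y 0 / x 0, ?_⟩
    have : y 1 = 0 := by simpa [h1, h0] using h
    ext i
    fin_cases i <;> simp [h0, h1, this]
  · refine ⟨y 1 / x 1, ?_⟩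
    ext i
    fin_cases i
    · simp; field_simp; linear_combination h
    · simp [h1]

end

noncomputable section

/-! ### Contraction of functionals on quintic forms -/

section Contract

variable {R S : Type*} [CommRing R] [CommRing S]

/-- Extension of a vector by zero. -/
def extendZero {n : ℕ} (v : Fin n → R) (i : ℕ) : R := if h : i < n then v ⟨i, h⟩ else 0

theorem extendZero_apply {n : ℕ} (v : Fin n → R) {i : ℕ} (h : i < n) :
    extendZero v i = v ⟨i, h⟩ := dif_pos h

theorem map_extendZero (φ : R →+* S) {n : ℕ} (v : Fin n → R) (i : ℕ) :
    φ (extendZero v i) = extendZero (fun j => φ (v j)) i := by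
  unfold extendZero; split <;> simp

/-- Contraction of a functional `ν` on forms of degree five with a form `g` of degree `k`: the
functional `h ↦ ν (g h)`. -/
def contract {k : ℕ} (m : ℕ) (g : Fin (k + 1) → R) : (Fin 6 → R) →ₗ[R] (Fin (m + 1) → R) where
  -- When `k + m = 5` all indices `i + j` are at most `5`, so the default value of `extendZero` is
  -- never read.
  toFun ν i := ∑ j, g j * extendZero ν ((i : ℕ) + j)
  map_add' ν μ := by
    ext i
    simp only [Pi.add_apply, ← Finset.sum_add_distrib, ← mul_add]
    refine Finset.sum_congr rfl fun j _ => ?_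
    congr 1
    unfold extendZero; split <;> simp
  map_smul' t ν := by
    ext i
    simp only [Pi.smul_apply, smul_eq_mul, RingHom.id_apply, Finset.mul_sum]
    refine Finset.sum_congr rfl fun j _ => ?_
    unfold extendZero; split <;> simp [mul_left_comm]

theorem contract_apply {k m : ℕ} (g : Fin (k + 1) → R) (ν : Fin 6 → R) (i : Fin (m + 1)) :
    contract m g ν i = ∑ j, g j * extendZero ν ((i : ℕ) + j) := rfl

theorem map_contract (φ : R →+* S) {k m : ℕ} (g : Fin (k + 1) → R) (ν : Fin 6 → R)
    (i : Fin (m + 1)) :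
    φ (contract m g ν i) = contract m (fun j => φ (g j)) (fun j => φ (ν j)) i := by
  simp [contract_apply, map_extendZero]

theorem contract_smul_left {k m : ℕ} (t : R) (g : Fin (k + 1) → R) (ν : Fin 6 → R) :
    contract m (t • g) ν = t • contract m g ν := by
  ext i
  simp [contract_apply, Finset.mul_sum, mul_assoc]

end Contract

/-- Contraction with `g` is the transpose of multiplication by `g`. -/
theorem sum_mul_coeff_binaryForm_mul {k m : ℕ} (hkm : k + m = 5) (g : Fin (k + 1) → ℂ)
    (h : Fin (m + 1) → ℂ) {f : Fin 6 → ℂ} (hf : binaryForm 5 f = binaryForm k g * binaryForm m h)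
    (ν : Fin 6 → ℂ) : ∑ l, f l * ν l = ∑ i, h i * contract m g ν i := by
  have hfl : ∀ l : Fin 6, f l = ∑ j : Fin (k + 1), ∑ i : Fin (m + 1),
      if (l : ℕ) = (i : ℕ) + j then g j * h i else 0 := by
    intro l
    rw [← coeff_binaryForm (d := 5) f l, hf, binaryForm_mul]
    simp only [coeff_sum, X_pow_mul_X_pow_eq_monomial, coeff_C_mul, coeff_monomial,
      binaryExponent_inj]
    refine Finset.sum_congr rfl fun j _ => Finset.sum_congr rfl fun i _ => ?_
    by_cases hl : (l : ℕ) = i + j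
    · rw [if_pos ⟨hl.symm, by omega⟩, if_pos hl, mul_one]
    · rw [if_neg (fun h => hl h.1.symm), if_neg hl, mul_zero]
  have e1 : ∑ l, f l * ν l =
      ∑ l : Fin 6, ∑ j : Fin (k + 1), ∑ i : Fin (m + 1),
        if (l : ℕ) = (i : ℕ) + j then g j * h i * ν l else 0 := by
    refine Finset.sum_congr rfl fun l _ => ?_
    rw [hfl l, Finset.sum_mul]
    refine Finset.sum_congr rfl fun j _ => ?_
    rw [Finset.sum_mul]
    exact Finset.sum_congr rfl fun i _ => by split <;> simp
  have e2 : ∑ i, h i * contract m g ν i =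
      ∑ i : Fin (m + 1), ∑ j : Fin (k + 1), g j * h i * extendZero ν ((i : ℕ) + j) := by
    refine Finset.sum_congr rfl fun i _ => ?_
    rw [contract_apply, Finset.mul_sum]
    exact Finset.sum_congr rfl fun j _ => by ring
  rw [e1, e2, Finset.sum_comm, Finset.sum_comm (s := (Finset.univ : Finset (Fin (m + 1))))]
  refine Finset.sum_congr rfl fun j _ => ?_
  rw [Finset.sum_comm]
  refine Finset.sum_congr rfl fun i _ => ?_
  have hlt : (i : ℕ) + j < 6 := by have := i.2; have := j.2; omega
  rw [Finset.sum_eq_single ⟨(i : ℕ) + j, hlt⟩]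
  · rw [if_pos rfl, extendZero_apply _ hlt]
  · intro l _ hl
    rw [if_neg]
    exact fun h => hl (Fin.ext h)
  · simp

theorem exists_binaryForm_mul {k m : ℕ} (hkm : k + m = 5) (g : Fin (k + 1) → ℂ)
    (h : Fin (m + 1) → ℂ) : ∃ f, binaryForm 5 f = binaryForm k g * binaryForm m h := by
  have := (binaryForm_isHomogeneous g).mul (binaryForm_isHomogeneous h)
  rw [hkm] at this
  obtain ⟨a, ha⟩ := this.exists_eq_binaryForm
  exact ⟨a, ha.symm⟩

/-- The functionals on quintic forms which vanish on the multiples of `g`. -/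
def annihilator {k : ℕ} (m : ℕ) (g : Fin (k + 1) → ℂ) : Submodule ℂ (Fin 6 → ℂ) :=
  LinearMap.ker (contract m g)

theorem mem_annihilator {k m : ℕ} {g : Fin (k + 1) → ℂ} {ν : Fin 6 → ℂ} :
    ν ∈ annihilator m g ↔ contract m g ν = 0 := LinearMap.mem_ker

/-- This is dual to the injectivity of multiplication by `g`: a functional which kills the image is
a form `h` with `g h = 0`. -/
theorem contract_surjective {k m : ℕ} (hkm : k + m = 5) {g : Fin (k + 1) → ℂ} (hg : g ≠ 0) :
    Function.Surjective (contract m g) := by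
  rw [← LinearMap.range_eq_top]
  by_contra hne
  obtain ⟨φ, hφ, hle⟩ := Submodule.exists_le_ker_of_lt_top _ (lt_top_iff_ne_top.2 hne)
  apply hφ
  set h : Fin (m + 1) → ℂ := fun i => φ (Pi.single i 1) with hh
  have hφh : ∀ w, φ w = ∑ i, h i * w i := by
    intro w
    conv_lhs => rw [← LinearMap.sum_single_apply (φ := fun _ => ℂ) w, map_sum]
    refine Finset.sum_congr rfl fun i _ => ?_
    rw [hh, mul_comm, ← smul_eq_mul, ← map_smul]
    congr 1
    rw [← Pi.single_smul]
    simp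
  obtain ⟨f, hf⟩ := exists_binaryForm_mul hkm g h
  have hf0 : f = 0 := by
    funext l
    have := sum_mul_coeff_binaryForm_mul hkm g h hf (Pi.single l 1)
    rw [← hφh, LinearMap.mem_ker.1 (hle ⟨_, rfl⟩)] at this
    simpa [Pi.single_apply] using this
  rw [hf0, binaryForm_zero, eq_comm, mul_eq_zero, binaryForm_eq_zero_iff,
    binaryForm_eq_zero_iff] at hf
  have h0 := hf.resolve_left hg
  ext i
  simp [hφh, h0]

theorem finrank_annihilator {k m : ℕ} (hkm : k + m = 5) {g : Fin (k + 1) → ℂ} (hg : g ≠ 0) :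
    Module.finrank ℂ (annihilator m g) = k := by
  have h := LinearMap.finrank_range_add_finrank_ker (contract m g)
  rw [LinearMap.range_eq_top.2 (contract_surjective hkm hg), finrank_top] at h
  simp only [Module.finrank_fin_fun] at h
  unfold annihilator
  omega

/-- A quintic form is divisible by `g` if it is killed by the functionals which vanish on the
multiples of `g`. -/
theorem binaryForm_dvd_iff {k m : ℕ} (hkm : k + m = 5) {g : Fin (k + 1) → ℂ} {f : Fin 6 → ℂ} :
    binaryForm k g ∣ binaryForm 5 f ↔ ∀ ν ∈ annihilator m g, ∑ l, f l * ν l = 0 := by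
  constructor
  · intro h ν hν
    have h5 : (binaryForm 5 f).IsHomogeneous (k + m) := by
      rw [hkm]; exact binaryForm_isHomogeneous f
    obtain ⟨q, hq, hfq⟩ := h5.exists_eq_mul_of_dvd (binaryForm_isHomogeneous g) h
    obtain ⟨h, rfl⟩ := hq.exists_eq_binaryForm
    rw [sum_mul_coeff_binaryForm_mul hkm g h hfq, mem_annihilator.1 hν]
    simp
  · intro h
    -- `μ` is multiplication by `g` on coefficient vectors. A quintic outside its range is separated
    -- from it by a functional, which then lies in `annihilator m g`.
    choose μ hμ using exists_binaryForm_mul hkm g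
    have hadd : ∀ a b, μ (a + b) = μ a + μ b := fun a b => binaryForm_injective 5 (by
      rw [hμ, binaryForm_add, binaryForm_add, mul_add, hμ, hμ])
    have hsmul : ∀ (t : ℂ) a, μ (t • a) = t • μ a := fun t a => binaryForm_injective 5 (by
      rw [hμ, binaryForm_smul, binaryForm_smul, hμ]; ring)
    let μl : (Fin (m + 1) → ℂ) →ₗ[ℂ] (Fin 6 → ℂ) := ⟨⟨μ, hadd⟩, hsmul⟩
    by_cases hf : f ∈ LinearMap.range μl
    · obtain ⟨a, rfl⟩ := hf
      exact ⟨_, hμ a⟩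
    · exfalso
      obtain ⟨φ, hφ, hle⟩ := Submodule.exists_le_ker_of_notMem hf
      have hφν : ∀ w, φ w = ∑ l, w l * φ (Pi.single l 1) := by
        intro w
        conv_lhs => rw [← LinearMap.sum_single_apply (φ := fun _ => ℂ) w, map_sum]
        refine Finset.sum_congr rfl fun i _ => ?_
        rw [← smul_eq_mul, ← map_smul]
        congr 1
        rw [← Pi.single_smul]
        simp
      apply hφ
      rw [hφν]
      refine h _ (mem_annihilator.2 ?_)
      ext i
      have h1 : φ (μ (Pi.single i 1)) = 0 := LinearMap.mem_ker.1 (hle ⟨Pi.single i 1, rfl⟩)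
      rw [hφν, sum_mul_coeff_binaryForm_mul hkm g _ (hμ _)] at h1
      simpa [Pi.single_apply] using h1

theorem mem_annihilator_iff {k m : ℕ} (hkm : k + m = 5) {g : Fin (k + 1) → ℂ} {ν : Fin 6 → ℂ} :
    ν ∈ annihilator m g ↔ ∀ f, binaryForm k g ∣ binaryForm 5 f → ∑ l, f l * ν l = 0 := by
  refine ⟨fun h f hf => (binaryForm_dvd_iff hkm).1 hf ν h, fun h => mem_annihilator.2 ?_⟩
  ext i
  obtain ⟨f, hf⟩ := exists_binaryForm_mul hkm g (Pi.single i 1)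
  have h1 := h f ⟨_, hf⟩
  rw [sum_mul_coeff_binaryForm_mul hkm g _ hf] at h1
  simpa [Pi.single_apply] using h1

/-- Contraction with a product vanishes if contraction with a factor does. -/
theorem annihilator_le_of_dvd {k m k' m' : ℕ} (hkm : k + m = 5) (hkm' : k' + m' = 5)
    {g : Fin (k + 1) → ℂ} {g' : Fin (k' + 1) → ℂ} (h : binaryForm k g ∣ binaryForm k' g') :
    annihilator m g ≤ annihilator m' g' := by
  intro ν hν
  rw [mem_annihilator_iff hkm']
  exact fun f hf => (binaryForm_dvd_iff hkm).1 (h.trans hf) ν hν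

end

noncomputable section

/-! ### Evaluation functionals and the embedding condition -/

/-- Evaluation of quintic forms at `x`. -/
def evalVec (x : Fin 2 → ℂ) : Fin 6 → ℂ := fun l => x 0 ^ (l : ℕ) * x 1 ^ (5 - (l : ℕ))

/-- Evaluation at `x` of the partial derivatives of quintic forms. -/
def derivVec (j : Fin 2) (x : Fin 2 → ℂ) : Fin 6 → ℂ := fun l =>
  eval x (pderiv j (X 0 ^ (l : ℕ) * X 1 ^ (5 - (l : ℕ))))

theorem sum_mul_evalVec (f : Fin 6 → ℂ) (x : Fin 2 → ℂ) :
    ∑ l, f l * evalVec x l = eval x (binaryForm 5 f) := by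
  rw [eval_binaryForm]; rfl

theorem sum_mul_derivVec (f : Fin 6 → ℂ) (j : Fin 2) (x : Fin 2 → ℂ) :
    ∑ l, f l * derivVec j x l = eval x (pderiv j (binaryForm 5 f)) := by
  simp only [binaryForm, map_sum, pderiv_C_mul, derivVec, map_mul, eval_C]

theorem evalVec_mem_annihilator {k m : ℕ} (hkm : k + m = 5) {g : Fin (k + 1) → ℂ}
    {x : Fin 2 → ℂ} (h : eval x (binaryForm k g) = 0) : evalVec x ∈ annihilator m g := by
  rw [mem_annihilator_iff hkm]
  rintro f ⟨q, hq⟩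
  rw [sum_mul_evalVec, hq, map_mul, h, zero_mul]

theorem derivVec_mem_annihilator {k m : ℕ} (hkm : k + m = 5) {g : Fin (k + 1) → ℂ}
    {x : Fin 2 → ℂ} (h : linForm x ^ 2 ∣ binaryForm k g) (j : Fin 2) :
    derivVec j x ∈ annihilator m g := by
  rw [mem_annihilator_iff hkm]
  intro f hf
  obtain ⟨q, hq⟩ := h.trans hf
  have hx : eval x (linForm x) = 0 := by rw [eval_linForm]; ring
  rw [sum_mul_derivVec, hq, pow_two, pderiv_mul, pderiv_mul]
  simp [hx]

/-- A subspace of functionals on quintic forms which contains no nonzero functional vanishing on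
the multiples of a quadratic form: the linear system it annihilates embeds `ℙ¹`. -/
def IsSeparating (K : Submodule ℂ (Fin 6 → ℂ)) : Prop :=
  ∀ q : Fin 3 → ℂ, q ≠ 0 → ∀ ν ∈ K, ν ∈ annihilator 3 q → ν = 0

theorem exists_linForm_mul_linForm {q : Fin 3 → ℂ} (hq : q ≠ 0) :
    ∃ x y : Fin 2 → ℂ, x ≠ 0 ∧ y ≠ 0 ∧ binaryForm 2 q = linForm x * linForm y := by
  obtain ⟨x, hx, g, hg, hqg⟩ := exists_eq_linForm_mul_of_isHomogeneous (binaryForm_isHomogeneous q)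
  obtain ⟨a, rfl⟩ := hg.exists_eq_binaryForm
  refine ⟨x, ![-a 0, a 1], hx, ?_, by rw [hqg, binaryForm_one]⟩
  intro h0
  apply hq
  rw [← binaryForm_eq_zero_iff, hqg, binaryForm_one, h0]
  simp [linForm]

/-- `annihilator 3 q` is two-dimensional, so it is spanned by the two `ν j`, and `T` is injective on
it. -/
theorem eq_zero_of_mem_annihilator {V : Type*} [AddCommGroup V] [Module ℂ V]
    (T : (Fin 6 → ℂ) →ₗ[ℂ] V) {q : Fin 3 → ℂ} (hq : q ≠ 0) {ν : Fin 2 → Fin 6 → ℂ}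
    (hν : ∀ j, ν j ∈ annihilator 3 q) (hT : LinearIndependent ℂ fun j => T (ν j))
    {μ : Fin 6 → ℂ} (hμ : μ ∈ annihilator 3 q) (h0 : T μ = 0) : μ = 0 := by
  have hf := finrank_annihilator (k := 2) (m := 3) rfl hq
  have hli : LinearIndependent ℂ ν := LinearIndependent.of_comp T hT
  have hsp : Submodule.span ℂ (Set.range ν) = annihilator 3 q := by
    apply Submodule.eq_of_le_of_finrank_le
    · rw [Submodule.span_le]
      rintro _ ⟨j, rfl⟩
      exact hν j
    · rw [hf, finrank_span_eq_card hli]; simp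
  rw [← hsp, Submodule.mem_span_range_iff_exists_fun] at hμ
  obtain ⟨c, rfl⟩ := hμ
  have hc := Fintype.linearIndependent_iff.1 hT c (by simpa using h0)
  simp [hc]

namespace SmoothRationalCurve

variable {n : ℕ} (C : SmoothRationalCurve n 5)

/-- The coefficients of the coordinate forms. -/
def coeffs (i : Fin (n + 1)) : Fin 6 → ℂ := (C.homogeneous i).exists_eq_binaryForm.choose

theorem form_eq (i : Fin (n + 1)) : C.form i = binaryForm 5 (C.coeffs i) :=
  (C.homogeneous i).exists_eq_binaryForm.choose_spec

/-- The transpose of the restriction of linear forms to the curve. -/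
def spanMap : (Fin 6 → ℂ) →ₗ[ℂ] (Fin (n + 1) → ℂ) := Matrix.mulVecLin (Matrix.of C.coeffs)

theorem spanMap_apply (ν : Fin 6 → ℂ) (i : Fin (n + 1)) :
    C.spanMap ν i = ∑ l, C.coeffs i l * ν l := rfl

theorem spanMap_evalVec (x : Fin 2 → ℂ) : C.spanMap (evalVec x) = evalForms C.form x := by
  ext i
  rw [spanMap_apply, sum_mul_evalVec, ← form_eq]; rfl

theorem spanMap_derivVec (j : Fin 2) (x : Fin 2 → ℂ) :
    C.spanMap (derivVec j x) = evalForms (fun i => pderiv j (C.form i)) x := by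
  ext i
  rw [spanMap_apply, sum_mul_derivVec, ← form_eq]; rfl

/-- The coefficients of the restriction of a linear form. -/
def restrictCoeffs (ℓ : Module.Dual ℂ (Fin (n + 1) → ℂ)) : Fin 6 → ℂ :=
  fun l => ∑ i, ℓ (Pi.single i 1) * C.coeffs i l

theorem restrict_eq (ℓ : Module.Dual ℂ (Fin (n + 1) → ℂ)) :
    C.restrict ℓ = binaryForm 5 (C.restrictCoeffs ℓ) := by
  simp only [restrict, form_eq, binaryForm, restrictCoeffs, map_sum, Finset.mul_sum,
    Finset.sum_mul]
  rw [Finset.sum_comm]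
  simp [mul_assoc]

theorem _root_.Module.Dual.apply_eq_sum {n : ℕ} (ℓ : Module.Dual ℂ (Fin n → ℂ)) (v : Fin n → ℂ) :
    ℓ v = ∑ i, ℓ (Pi.single i 1) * v i := by
  conv_lhs => rw [← LinearMap.sum_single_apply (φ := fun _ => ℂ) v, map_sum]
  refine Finset.sum_congr rfl fun i _ => ?_
  rw [mul_comm, ← smul_eq_mul, ← map_smul]
  congr 1
  rw [← Pi.single_smul]
  simp

theorem sum_restrictCoeffs_mul (ℓ : Module.Dual ℂ (Fin (n + 1) → ℂ)) (ν : Fin 6 → ℂ) :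
    ∑ l, C.restrictCoeffs ℓ l * ν l = ℓ (C.spanMap ν) := by
  rw [ℓ.apply_eq_sum]
  simp only [restrictCoeffs, spanMap_apply, Finset.sum_mul, Finset.mul_sum]
  rw [Finset.sum_comm]
  simp [mul_assoc]

theorem forall_dvd_restrict_iff {k m : ℕ} (hkm : k + m = 5) (L : LineIn n)
    (g : Fin (k + 1) → ℂ) :
    (∀ ℓ ∈ L.1.dualAnnihilator, binaryForm k g ∣ C.restrict ℓ) ↔
      (annihilator m g).map C.spanMap ≤ L.1 := by
  constructor
  · rintro h _ ⟨ν, hν, rfl⟩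
    rw [← Subspace.dualAnnihilator_dualCoannihilator_eq (W := L.1)]
    rw [Submodule.mem_dualCoannihilator]
    intro ℓ hℓ
    have h1 := h ℓ hℓ
    rw [restrict_eq, binaryForm_dvd_iff hkm] at h1
    rw [← sum_restrictCoeffs_mul]
    exact h1 ν hν
  · intro h ℓ hℓ
    rw [restrict_eq, binaryForm_dvd_iff hkm]
    intro ν hν
    rw [sum_restrictCoeffs_mul]
    exact (Submodule.mem_dualAnnihilator ℓ).1 hℓ _ (h ⟨ν, hν, rfl⟩)

theorem isSecant_iff {k m : ℕ} (hkm : k + m = 5) (L : LineIn n) :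
    C.IsSecant k L ↔
      ∃ g : Fin (k + 1) → ℂ, g ≠ 0 ∧ (annihilator m g).map C.spanMap ≤ L.1 := by
  constructor
  · rintro ⟨g, hg0, hg, h⟩
    obtain ⟨a, rfl⟩ := hg.exists_eq_binaryForm
    exact ⟨a, fun h0 => hg0 (by rw [h0, binaryForm_zero]), (C.forall_dvd_restrict_iff hkm L a).1 h⟩
  · rintro ⟨a, ha, h⟩
    exact ⟨binaryForm k a, fun h0 => ha (binaryForm_eq_zero_iff.1 h0),
      binaryForm_isHomogeneous a, (C.forall_dvd_restrict_iff hkm L a).2 h⟩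

theorem onPoints_mk {x : Fin 2 → ℂ} (hx : x ≠ 0) :
    C.toProjLineMorphism.onPoints (Projectivization.mk ℂ x hx) =
      Projectivization.mk ℂ (evalForms C.form x) (C.base_point_free x hx) := rfl

theorem linearIndependent_evalForms {x y : Fin 2 → ℂ} (hx : x ≠ 0) (hy : y ≠ 0)
    (h : ¬ ∃ t : ℂ, y = t • x) :
    LinearIndependent ℂ ![evalForms C.form x, evalForms C.form y] := by
  rw [LinearIndependent.pair_iff' (C.base_point_free x hx)]
  intro t ht
  apply h
  have h1 : C.toProjLineMorphism.onPoints (Projectivization.mk ℂ y hy) =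
      C.toProjLineMorphism.onPoints (Projectivization.mk ℂ x hx) := by
    rw [onPoints_mk, onPoints_mk, Projectivization.mk_eq_mk_iff']
    exact ⟨t, ht⟩
  have h2 := C.injective h1
  rw [Projectivization.mk_eq_mk_iff'] at h2
  obtain ⟨s, hs⟩ := h2
  exact ⟨s, hs.symm⟩

/-- A quadratic form is a product of two linear forms. For distinct roots its annihilator is spanned
by the two evaluations, which stay independent because the curve map is injective; for a double root
it is spanned by the two derivative functionals, which stay independent because the map is an
immersion. -/
theorem isSeparating_ker_spanMap : IsSeparating (LinearMap.ker C.spanMap) := by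
  intro q hq ν hν hνq
  obtain ⟨x, y, hx, hy, hxy⟩ := exists_linForm_mul_linForm hq
  have hxx : eval x (linForm x) = 0 := by rw [eval_linForm]; ring
  have hyy : eval y (linForm y) = 0 := by rw [eval_linForm]; ring
  by_cases h : ∃ t : ℂ, y = t • x
  · obtain ⟨t, rfl⟩ := h
    have hsq : linForm x ^ 2 ∣ binaryForm 2 q := by
      refine ⟨MvPolynomial.C t, ?_⟩
      rw [hxy]
      simp only [linForm, Pi.smul_apply, smul_eq_mul, C_mul]
      ring
    refine eq_zero_of_mem_annihilator C.spanMap hq (ν := fun j => derivVec j x)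
      (fun j => derivVec_mem_annihilator rfl hsq j) ?_ hνq hν
    simp only [spanMap_derivVec]
    exact C.immersion x hx
  · refine eq_zero_of_mem_annihilator C.spanMap hq (ν := ![evalVec x, evalVec y]) ?_ ?_ hνq hν
    · intro j
      fin_cases j
      · exact evalVec_mem_annihilator rfl (by rw [hxy, map_mul, hxx, zero_mul])
      · exact evalVec_mem_annihilator rfl (by rw [hxy, map_mul, hyy, mul_zero])
    · have e : (fun j => C.spanMap (![evalVec x, evalVec y] j)) =
          ![evalForms C.form x, evalForms C.form y] := by
        funext j
        fin_cases j <;> simp [spanMap_evalVec]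
      rw [e]
      exact C.linearIndependent_evalForms hx hy h

end SmoothRationalCurve

end

noncomputable section

/-! ### Trisecant lines and functionals killed by cubic forms -/

theorem finrank_map_add_finrank_ker_inf {V W : Type*} [AddCommGroup V] [Module ℂ V]
    [AddCommGroup W] [Module ℂ W] [FiniteDimensional ℂ V] (T : V →ₗ[ℂ] W) (p : Submodule ℂ V) :
    Module.finrank ℂ (p.map T) + Module.finrank ℂ (LinearMap.ker T ⊓ p : Submodule ℂ V) =
      Module.finrank ℂ p := by
  have h := LinearMap.finrank_range_add_finrank_ker (T.domRestrict p)
  rw [LinearMap.range_domRestrict, LinearMap.ker_domRestrict] at h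
  rw [← h]
  congr 1
  have h2 : (LinearMap.ker T ⊓ p : Submodule ℂ V) =
      ((LinearMap.ker T).comap p.subtype).map p.subtype := by
    rw [Submodule.map_comap_subtype, inf_comm]
  rw [h2, Submodule.finrank_map_subtype_eq]

/-- The Hankel map `g ↦ (h ↦ ν (g h))` of a functional `ν`. -/
def hankel (ν : Fin 6 → ℂ) : (Fin 4 → ℂ) →ₗ[ℂ] (Fin 3 → ℂ) where
  toFun g := contract 2 g ν
  map_add' g g' := by
    ext i
    simp [contract_apply (k := 3), add_mul, Finset.sum_add_distrib]
  map_smul' t g := by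
    simpa using contract_smul_left (k := 3) t g ν

theorem hankel_apply (ν : Fin 6 → ℂ) (g : Fin 4 → ℂ) : hankel ν g = contract (k := 3) 2 g ν := rfl

theorem hankel_eq_zero_iff {ν : Fin 6 → ℂ} {g : Fin 4 → ℂ} :
    hankel ν g = 0 ↔ ν ∈ annihilator (k := 3) 2 g := mem_annihilator.symm

namespace IsSeparating

variable {K : Submodule ℂ (Fin 6 → ℂ)} (hK : IsSeparating K)

include hK

/-- By the symmetry of `ν (g h)` in `g` and `h`, a functional vanishing on the image is a quadratic
form which contracts `ν` to zero. This puts `ν` on a secant or tangent line of the rational normal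
quintic, which separation forbids. -/
theorem hankel_surjective {ν : Fin 6 → ℂ} (hν : ν ∈ K) (h0 : ν ≠ 0) :
    Function.Surjective (hankel ν) := by
  rw [← LinearMap.range_eq_top]
  by_contra hne
  obtain ⟨φ, hφ, hle⟩ := Submodule.exists_le_ker_of_lt_top _ (lt_top_iff_ne_top.2 hne)
  refine h0 (hK (fun i => φ (Pi.single i 1)) ?_ ν hν (mem_annihilator.2 ?_))
  · intro h
    apply hφ
    ext i
    simpa using congrFun h i
  · ext j
    have h1 : φ (hankel ν (Pi.single j 1)) = 0 := LinearMap.mem_ker.1 (hle ⟨_, rfl⟩)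
    rw [Module.Dual.apply_eq_sum φ] at h1
    simp only [hankel_apply, contract_apply, Pi.single_apply, ite_mul, one_mul, zero_mul,
      Finset.sum_ite_eq', Finset.mem_univ, if_true] at h1
    rw [contract_apply, Pi.zero_apply, ← h1]
    exact Finset.sum_congr rfl fun i _ => by rw [add_comm]

theorem finrank_ker_hankel {ν : Fin 6 → ℂ} (hν : ν ∈ K) (h0 : ν ≠ 0) :
    Module.finrank ℂ (LinearMap.ker (hankel ν)) = 1 := by
  have h := LinearMap.finrank_range_add_finrank_ker (hankel ν)
  rw [LinearMap.range_eq_top.2 (hK.hankel_surjective hν h0), finrank_top] at h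
  simp only [Module.finrank_fin_fun] at h
  omega

theorem exists_cubic {ν : Fin 6 → ℂ} (hν : ν ∈ K) (h0 : ν ≠ 0) :
    ∃ g : Fin 4 → ℂ, g ≠ 0 ∧ ν ∈ annihilator (k := 3) 2 g := by
  have h := hK.finrank_ker_hankel hν h0
  obtain ⟨⟨g, hg⟩, hg0, -⟩ := finrank_eq_one_iff'.1 h
  exact ⟨g, fun h => hg0 (Subtype.ext h), hankel_eq_zero_iff.1 hg⟩

theorem eq_smul_cubic {ν : Fin 6 → ℂ} (hν : ν ∈ K) (h0 : ν ≠ 0) {g g' : Fin 4 → ℂ} (hg : g ≠ 0)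
    (h : ν ∈ annihilator (k := 3) 2 g) (h' : ν ∈ annihilator (k := 3) 2 g') :
    ∃ t : ℂ, g' = t • g := by
  have hf := hK.finrank_ker_hankel hν h0
  have h1 := (finrank_eq_one_iff_of_nonzero'
    (⟨g, hankel_eq_zero_iff.2 h⟩ : LinearMap.ker (hankel ν))
    (fun h => hg (congrArg Subtype.val h))).1 hf ⟨g', hankel_eq_zero_iff.2 h'⟩
  obtain ⟨t, ht⟩ := h1
  exact ⟨t, (congrArg Subtype.val ht).symm⟩

theorem annihilator_eq_of_mem {ν : Fin 6 → ℂ} (hν : ν ∈ K) (h0 : ν ≠ 0) {g g' : Fin 4 → ℂ}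
    (hg : g ≠ 0) (hg' : g' ≠ 0)
    (h : ν ∈ annihilator (k := 3) 2 g) (h' : ν ∈ annihilator (k := 3) 2 g') :
    annihilator (k := 3) 2 g' = annihilator (k := 3) 2 g := by
  obtain ⟨t, rfl⟩ := hK.eq_smul_cubic hν h0 hg h h'
  have ht : t ≠ 0 := fun h => hg' (by rw [h, zero_smul])
  ext μ
  rw [mem_annihilator, mem_annihilator, contract_smul_left, smul_eq_zero_iff_right ht]

/-- A quadratic factor `q` of `g` gives the hyperplane `annihilator 3 q` of the three-dimensional
`annihilator 2 g`, and `K` meets this hyperplane only in zero. -/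
theorem finrank_inf_annihilator_le {g : Fin 4 → ℂ} (hg : g ≠ 0) :
    Module.finrank ℂ (K ⊓ annihilator (k := 3) 2 g : Submodule ℂ (Fin 6 → ℂ)) ≤ 1 := by
  obtain ⟨x, hx, q, hq, hgq⟩ := exists_eq_linForm_mul_of_isHomogeneous
    (binaryForm_isHomogeneous (d := 3) g)
  obtain ⟨q, rfl⟩ := hq.exists_eq_binaryForm
  have hq0 : q ≠ 0 := by
    rintro rfl
    rw [binaryForm_zero, mul_zero, binaryForm_eq_zero_iff] at hgq
    exact hg hgq
  have hle : annihilator (k := 2) 3 q ≤ annihilator (k := 3) 2 g :=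
    annihilator_le_of_dvd rfl rfl ⟨linForm x, by rw [hgq, mul_comm]⟩
  have h1 := Submodule.finrank_sup_add_finrank_inf_eq (K ⊓ annihilator (k := 3) 2 g)
    (annihilator (k := 2) 3 q)
  have hbot : (K ⊓ annihilator (k := 3) 2 g) ⊓ annihilator (k := 2) 3 q = ⊥ := by
    rw [eq_bot_iff]
    rintro ν ⟨⟨h1, -⟩, h2⟩
    exact hK q hq0 ν h1 h2
  have hle2 := Submodule.finrank_mono (sup_le inf_le_right hle :
    (K ⊓ annihilator (k := 3) 2 g) ⊔ annihilator (k := 2) 3 q ≤ annihilator (k := 3) 2 g)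
  rw [hbot, finrank_bot, finrank_annihilator (k := 2) rfl hq0] at h1
  rw [finrank_annihilator (k := 3) rfl hg] at hle2
  omega

end IsSeparating

namespace SmoothRationalCurve

variable {n : ℕ} (C : SmoothRationalCurve n 5)

theorem finrank_map_annihilator {ν : Fin 6 → ℂ} (hν : C.spanMap ν = 0) (h0 : ν ≠ 0)
    {g : Fin 4 → ℂ} (hg : g ≠ 0) (h : ν ∈ annihilator (k := 3) 2 g) :
    Module.finrank ℂ ((annihilator (k := 3) 2 g).map C.spanMap) = 2 := by
  have h1 := finrank_map_add_finrank_ker_inf C.spanMap (annihilator (k := 3) 2 g)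
  have h2 := C.isSeparating_ker_spanMap.finrank_inf_annihilator_le hg
  have h3 : 0 < Module.finrank ℂ (LinearMap.ker C.spanMap ⊓ annihilator (k := 3) 2 g :
      Submodule ℂ (Fin 6 → ℂ)) :=
    Module.finrank_pos_iff_exists_ne_zero.2 ⟨⟨ν, hν, h⟩, fun h => h0 (congrArg Subtype.val h)⟩
  rw [finrank_annihilator (k := 3) rfl hg] at h1
  omega

/-- The span of `g` has dimension three and its image fits in a plane of vectors, so the span meets
the kernel; by `finrank_inf_annihilator_le` the intersection is one-dimensional, and the image fills
`L`. -/
theorem isSecant_three_iff (L : LineIn n) :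
    C.IsSecant 3 L ↔ ∃ ν : Fin 6 → ℂ, ν ≠ 0 ∧ C.spanMap ν = 0 ∧ ∃ g : Fin 4 → ℂ, g ≠ 0 ∧
      ν ∈ annihilator (k := 3) 2 g ∧ L.1 = (annihilator (k := 3) 2 g).map C.spanMap := by
  rw [C.isSecant_iff (k := 3) (m := 2) rfl]
  constructor
  · rintro ⟨g, hg, hle⟩
    have h1 := finrank_map_add_finrank_ker_inf C.spanMap (annihilator (k := 3) 2 g)
    have h2 := Submodule.finrank_mono hle
    rw [L.2] at h2
    rw [finrank_annihilator (k := 3) rfl hg] at h1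
    have h3 : 0 < Module.finrank ℂ (LinearMap.ker C.spanMap ⊓ annihilator (k := 3) 2 g :
      Submodule ℂ (Fin 6 → ℂ)) := by omega
    obtain ⟨⟨ν, hν, hνg⟩, hν0⟩ := Module.finrank_pos_iff_exists_ne_zero.1 h3
    have hν0' : ν ≠ 0 := fun h => hν0 (Subtype.ext h)
    refine ⟨ν, hν0', hν, g, hg, hνg, ?_⟩
    refine (Submodule.eq_of_le_of_finrank_le hle ?_).symm
    rw [L.2, C.finrank_map_annihilator hν hν0' hg hνg]
  · rintro ⟨ν, -, -, g, hg, -, h⟩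
    exact ⟨g, hg, h.ge⟩

theorem exists_isSecant_three {ν : Fin 6 → ℂ} (h0 : ν ≠ 0) (hν : C.spanMap ν = 0) :
    ∃ L : LineIn n, C.IsSecant 3 L ∧ ∃ g : Fin 4 → ℂ, g ≠ 0 ∧
      ν ∈ annihilator (k := 3) 2 g ∧ L.1 = (annihilator (k := 3) 2 g).map C.spanMap := by
  obtain ⟨g, hg, h⟩ := C.isSeparating_ker_spanMap.exists_cubic hν h0
  exact ⟨⟨_, C.finrank_map_annihilator hν h0 hg h⟩,
    (C.isSecant_three_iff _).2 ⟨ν, h0, hν, g, hg, h, rfl⟩, g, hg, h, rfl⟩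

theorem spanMap_surjective_of_nondegenerate (h : C.Nondegenerate) :
    Function.Surjective C.spanMap := by
  rw [← LinearMap.range_eq_top]
  by_contra hne
  obtain ⟨ℓ, hℓ, hle⟩ := Submodule.exists_le_ker_of_lt_top _ (lt_top_iff_ne_top.2 hne)
  obtain ⟨P, ⟨x, rfl⟩, hP⟩ := h ℓ hℓ
  induction x using Projectivization.ind with
  | h x hx =>
    apply hP
    rw [onPoints_mk]
    obtain ⟨a, ha⟩ := Projectivization.exists_smul_eq_mk_rep ℂ _ (C.base_point_free x hx)
    rw [← ha, ← spanMap_evalVec, Units.smul_def, map_smul,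
      LinearMap.mem_ker.1 (hle ⟨evalVec x, rfl⟩), smul_zero]

theorem finrank_ker_spanMap_of_surjective (h : Function.Surjective C.spanMap) :
    Module.finrank ℂ (LinearMap.ker C.spanMap) + (n + 1) = 6 := by
  have h1 := LinearMap.finrank_range_add_finrank_ker C.spanMap
  rw [LinearMap.range_eq_top.2 h, finrank_top] at h1
  simp only [Module.finrank_fin_fun] at h1
  omega

/-- A four-secant line of a curve spanning `ℙⁿ` forces two independent relations. -/
theorem two_le_finrank_of_annihilator_le {g : Fin 5 → ℂ} (hg : g ≠ 0) {L : LineIn n}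
    (h : (annihilator (k := 4) 1 g).map C.spanMap ≤ L.1) :
    2 ≤ Module.finrank ℂ (LinearMap.ker C.spanMap ⊓ annihilator (k := 4) 1 g :
      Submodule ℂ (Fin 6 → ℂ)) := by
  have h1 := finrank_map_add_finrank_ker_inf C.spanMap (annihilator (k := 4) 1 g)
  have h2 := Submodule.finrank_mono h
  rw [L.2] at h2
  rw [finrank_annihilator (k := 4) rfl hg] at h1
  omega

/-- A nondegenerate smooth rational quintic in `ℙ⁴` has a unique trisecant line. -/
theorem existsUnique_trisecant (C : SmoothRationalCurve 4 5) (hC : C.Nondegenerate) :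
    ∃ L : LineIn 4, C.IsSecant 3 L ∧ (∀ M : LineIn 4, C.IsSecant 3 M → M = L) ∧
      ¬ C.IsSecant 4 L := by
  have hf : Module.finrank ℂ (LinearMap.ker C.spanMap) = 1 := by
    have := C.finrank_ker_spanMap_of_surjective (C.spanMap_surjective_of_nondegenerate hC)
    omega
  obtain ⟨⟨ν, hν⟩, hν0, hspan⟩ := finrank_eq_one_iff'.1 hf
  have hν0' : ν ≠ 0 := fun h => hν0 (Subtype.ext h)
  obtain ⟨L, hL, g, hg, hνg, hLg⟩ := C.exists_isSecant_three hν0' hν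
  refine ⟨L, hL, ?_, ?_⟩
  · intro M hM
    obtain ⟨μ, hμ0, hμ, g', hg', hμg', hMg'⟩ := (C.isSecant_three_iff M).1 hM
    obtain ⟨t, ht⟩ := hspan ⟨μ, hμ⟩
    have ht' : t • ν = μ := congrArg Subtype.val ht
    have h1 : μ ∈ annihilator (k := 3) 2 g := ht' ▸ Submodule.smul_mem _ t hνg
    apply Subtype.ext
    rw [hMg', hLg, C.isSeparating_ker_spanMap.annihilator_eq_of_mem hμ hμ0 hg hg' h1 hμg']
  · intro h4
    obtain ⟨h, hh, hle⟩ := (C.isSecant_iff (k := 4) (m := 1) rfl L).1 h4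
    have h1 := C.two_le_finrank_of_annihilator_le hh hle
    have h2 := Submodule.finrank_mono (inf_le_left :
      LinearMap.ker C.spanMap ⊓ annihilator (k := 4) 1 h ≤ _)
    omega

end SmoothRationalCurve

end

noncomputable section

/-! ### A smooth rational quintic is not a plane curve -/

/-- A function of two variables which is polynomial and homogeneous of positive degree has a
nontrivial zero. -/
theorem exists_zero_of_homogeneous {f : ℂ → ℂ → ℂ} {n : ℕ} (hn : n ≠ 0)
    (hf : ∀ s x y, f (s * x) (s * y) = s ^ n * f x y) {p r : Polynomial ℂ}
    (hp : ∀ t, f 1 t = p.eval t) (hr : ∀ s, f s 1 = r.eval s) :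
    ∃ x y, (x ≠ 0 ∨ y ≠ 0) ∧ f x y = 0 := by
  by_cases hdeg : p.degree = 0
  · refine ⟨0, 1, Or.inr one_ne_zero, ?_⟩
    obtain ⟨c, hc⟩ : ∃ c, p = Polynomial.C c := ⟨_, Polynomial.eq_C_of_degree_eq_zero hdeg⟩
    -- If `f 1 t` is a nonzero constant `c`, homogeneity forces `f s 1 = c sⁿ`, which vanishes at `s
    -- = 0` since `n ≠ 0`.
    have hrX : r = Polynomial.C c * Polynomial.X ^ n := by
      refine Polynomial.eq_of_infinite_eval_eq _ _
        ((Set.finite_singleton (0 : ℂ)).infinite_compl.mono ?_)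
      intro s hs
      have hs : s ≠ 0 := hs
      have h := hf s 1 s⁻¹
      rw [mul_one, mul_inv_cancel₀ hs, hr, hp, hc] at h
      rw [Polynomial.eval_C] at h
      rw [Set.mem_ofPred_eq, h, Polynomial.eval_mul, Polynomial.eval_C, Polynomial.eval_pow,
        Polynomial.eval_X, mul_comm]
    rw [hr, hrX]
    simp [hn]
  · obtain ⟨t, ht⟩ := IsAlgClosed.exists_root p hdeg
    exact ⟨1, t, Or.inl one_ne_zero, by rw [hp]; exact ht⟩

section Minors

variable {R S : Type*} [CommRing R] [CommRing S]

/-- Contraction of a functional on quintics with the linear form `x X₀ - y X₁`. -/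
def linContract (x y : R) (ν : Fin 6 → R) : Fin 5 → R := fun j => x * ν j.succ - y * ν j.castSucc

/-- Contraction of a functional on quartics with the linear form `X₀ - t X₁`. -/
def affContract (t : R) (κ : Fin 5 → R) : Fin 4 → R := fun j => κ j.succ - t * κ j.castSucc

/-- The minors of the three vectors `(X₀ - t X₁)(x X₀ - y X₁) νᵢ`. -/
def contractMinor (ν : Fin 3 → Fin 6 → R) (x y t : R) (j : Fin 4) : R :=
  (Matrix.of fun i l : Fin 3 => affContract t (linContract x y (ν i)) (j.succAbove l)).det

/-- The determinant whose vanishing expresses that the pencil of quartics residual to `[x : y]`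
has a base point. -/
def pencilResultant (ν : Fin 3 → Fin 6 → R) (x y : R) : R :=
  (Matrix.of fun k j : Fin 4 => (-1) ^ (j : ℕ) * contractMinor ν x y ((k : ℕ) : R) j).det

theorem map_contractMinor (φ : R →+* S) (ν : Fin 3 → Fin 6 → R) (x y t : R) (j : Fin 4) :
    φ (contractMinor ν x y t j) = contractMinor (fun i l => φ (ν i l)) (φ x) (φ y) (φ t) j := by
  rw [contractMinor, RingHom.map_det]
  congr 1
  ext i l
  simp [affContract, linContract]

theorem map_pencilResultant (φ : R →+* S) (ν : Fin 3 → Fin 6 → R) (x y : R) :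
    φ (pencilResultant ν x y) = pencilResultant (fun i l => φ (ν i l)) (φ x) (φ y) := by
  rw [pencilResultant, RingHom.map_det]
  congr 1
  ext k j
  simp [map_contractMinor]

theorem contractMinor_mul (ν : Fin 3 → Fin 6 → R) (s x y t : R) (j : Fin 4) :
    contractMinor ν (s * x) (s * y) t j = s ^ 3 * contractMinor ν x y t j := by
  rw [contractMinor, contractMinor]
  convert Matrix.det_smul _ s using 2
  · ext i l
    simp [affContract, linContract]
    ring
  · simp

theorem pencilResultant_mul (ν : Fin 3 → Fin 6 → R) (s x y : R) :
    pencilResultant ν (s * x) (s * y) = s ^ 12 * pencilResultant ν x y := by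
  rw [pencilResultant, pencilResultant, show (12 : ℕ) = 3 * Fintype.card (Fin 4) by simp, pow_mul]
  convert Matrix.det_smul _ (s ^ 3) using 2
  ext k j
  simp [contractMinor_mul]
  ring

end Minors

/-- The resultant is homogeneous of degree `12` in `(x, y)`: four rows of `3 × 3` minors.
Geometrically, the six double points of a rational plane quintic have twelve preimages. -/
theorem exists_pencilResultant_eq_zero (ν : Fin 3 → Fin 6 → ℂ) :
    ∃ x y : ℂ, (x ≠ 0 ∨ y ≠ 0) ∧ pencilResultant ν x y = 0 := by
  refine exists_zero_of_homogeneous (n := 12) (by norm_num) (pencilResultant_mul ν)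
    (p := pencilResultant (fun i l => Polynomial.C (ν i l)) 1 Polynomial.X)
    (r := pencilResultant (fun i l => Polynomial.C (ν i l)) Polynomial.X 1) ?_ ?_
  · intro t
    rw [← Polynomial.coe_evalRingHom, map_pencilResultant]
    simp
  · intro t
    rw [← Polynomial.coe_evalRingHom, map_pencilResultant]
    simp

/-- The signed minors are polynomials of degree at most `3` in `t`, so a linear relation between
them at the four sample values `t = 0, 1, 2, 3` holds for every `t`. Such a relation is a kernel
vector of the resultant matrix. -/
theorem exists_forall_sum_contractMinor_eq_zero (ν : Fin 3 → Fin 6 → ℂ) :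
    ∃ x y : ℂ, (x ≠ 0 ∨ y ≠ 0) ∧ ∃ u : Fin 4 → ℂ, u ≠ 0 ∧
      ∀ t, ∑ j : Fin 4, (-1) ^ (j : ℕ) * u j * contractMinor ν x y t j = 0 := by
  obtain ⟨x, y, hxy, h⟩ := exists_pencilResultant_eq_zero ν
  obtain ⟨u, hu, hu0⟩ := Matrix.exists_mulVec_eq_zero_iff.2 h
  refine ⟨x, y, hxy, u, hu, ?_⟩
  set P : Polynomial ℂ := ∑ j : Fin 4, Polynomial.C ((-1) ^ (j : ℕ) * u j) *
    contractMinor (fun i l => Polynomial.C (ν i l)) (Polynomial.C x) (Polynomial.C y)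
      Polynomial.X j with hP
  have hev : ∀ t, P.eval t = ∑ j : Fin 4, (-1) ^ (j : ℕ) * u j * contractMinor ν x y t j := by
    intro t
    rw [hP, Polynomial.eval_finsetSum]
    refine Finset.sum_congr rfl fun j _ => ?_
    rw [Polynomial.eval_mul, Polynomial.eval_C]
    congr 1
    rw [← Polynomial.coe_evalRingHom, map_contractMinor]
    simp
  have hdeg : P.natDegree ≤ 3 := by
    refine Polynomial.natDegree_sum_le_of_forall_le _ _ fun j _ => ?_
    refine (Polynomial.natDegree_C_mul_le _ _).trans ?_
    rw [contractMinor]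
    refine le_trans (le_of_eq (congrArg Polynomial.natDegree (congrArg Matrix.det ?_)))
      ((Polynomial.natDegree_det_X_add_C_le
        (Matrix.of fun i l : Fin 3 => -linContract x y (ν i) (j.succAbove l).castSucc)
        (Matrix.of fun i l : Fin 3 => linContract x y (ν i) (j.succAbove l).succ)).trans (by simp))
    ext1 i l
    simp [affContract, linContract]
    ring
  have hP0 : P = 0 := by
    refine Polynomial.eq_zero_of_natDegree_lt_card_of_eval_eq_zero P
      (f := fun k : Fin 4 => ((k : ℕ) : ℂ)) ?_ ?_ (by simpa using hdeg.trans_lt (by norm_num))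
    · intro k k' hk
      exact Fin.ext (Nat.cast_injective (R := ℂ) hk)
    · intro k
      rw [hev, ← Pi.zero_apply (M := fun _ => ℂ) k, ← hu0]
      simp only [Matrix.mulVec, dotProduct, Matrix.of_apply]
      exact Finset.sum_congr rfl fun j _ => by ring
  intro t
  rw [← hev, hP0, Polynomial.eval_zero]

namespace IsSeparating

variable {K : Submodule ℂ (Fin 6 → ℂ)} (hK : IsSeparating K)

include hK

theorem eq_zero_of_linContract_eq_zero {ν : Fin 6 → ℂ} (hν : ν ∈ K) {x y : ℂ}
    (hxy : x ≠ 0 ∨ y ≠ 0) (h : ∀ j : Fin 4, linContract x y ν j.castSucc = 0) : ν = 0 := by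
  -- These are the coefficients of `X₁ (x X₀ - y X₁)`.
  refine hK ![-y, x, 0] ?_ ν hν (mem_annihilator.2 ?_)
  · intro h0
    have h1 := congrFun h0 0
    have h2 := congrFun h0 1
    simp at h1 h2
    tauto
  · ext i
    rw [contract_apply (k := 2), Fin.sum_univ_three]
    have h1 := h i
    fin_cases i <;> simp [extendZero, linContract] at h1 ⊢ <;> linear_combination h1

theorem eq_zero_of_affContract_eq_zero {ν : Fin 6 → ℂ} (hν : ν ∈ K) {x y t : ℂ}
    (hxy : x ≠ 0 ∨ y ≠ 0) (h : affContract t (linContract x y ν) = 0) : ν = 0 := by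
  -- These are the coefficients of `(X₀ - t X₁)(x X₀ - y X₁)`.
  refine hK ![y * t, -(y + t * x), x] ?_ ν hν (mem_annihilator.2 ?_)
  · intro h0
    have h1 := congrFun h0 1
    have h2 := congrFun h0 2
    simp at h1 h2
    simp [h2] at h1
    tauto
  · ext i
    rw [contract_apply (k := 2), Fin.sum_univ_three]
    have h1 := congrFun h i
    fin_cases i <;> simp [extendZero, linContract, affContract] at h1 ⊢ <;>
      linear_combination h1

/-- If `u` is a contraction of `K` by `(X₀ - t X₁)(x X₀ - y X₁)` for every `t`, then `u = 0`. -/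
theorem eq_zero_of_forall_exists_affContract {x y : ℂ} (hxy : x ≠ 0 ∨ y ≠ 0) {u : Fin 4 → ℂ}
    (hu : ∀ t, ∃ ν ∈ K, affContract t (linContract x y ν) = u) : u = 0 := by
  let lin : (Fin 6 → ℂ) →ₗ[ℂ] (Fin 5 → ℂ) :=
    { toFun := linContract x y
      map_add' := fun a b => by ext j; simp [linContract]; ring
      map_smul' := fun a b => by ext j; simp [linContract]; ring }
  -- `Z` consists of the quartics `f` for which `(x X₀ - y X₁) f` belongs to the linear system
  -- annihilated by `K`.
  let Z : Set (Fin 5 → ℂ) := {f | ∀ κ ∈ K.map lin, ∑ j, f j * κ j = 0}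
  have hZ : ∀ κ, κ ∉ K.map lin → ∃ f ∈ Z, ∑ j, f j * κ j ≠ 0 := by
    intro κ hκ
    obtain ⟨φ, hφ, hle⟩ := Submodule.exists_le_ker_of_notMem hκ
    refine ⟨fun j => φ (Pi.single j 1), fun κ' hκ' => ?_, ?_⟩
    · rw [← Module.Dual.apply_eq_sum φ]
      exact hle hκ'
    · rwa [← Module.Dual.apply_eq_sum φ]
  let pol : (Fin 5 → ℂ) → Polynomial ℂ := fun f =>
    Polynomial.C (f 4) * Polynomial.X ^ 4 + (Polynomial.C (f 3) * Polynomial.X ^ 3 +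
      Polynomial.C (f 2) * Polynomial.X ^ 2 + Polynomial.C (f 1) * Polynomial.X +
      Polynomial.C (f 0))
  let res : (Fin 5 → ℂ) → Polynomial ℂ := fun f =>
    Polynomial.C (f 4 * u 0) * Polynomial.X ^ 3 +
      Polynomial.C (f 3 * u 0 + f 4 * u 1) * Polynomial.X ^ 2 +
      Polynomial.C (f 2 * u 0 + f 3 * u 1 + f 4 * u 2) * Polynomial.X +
      Polynomial.C (f 1 * u 0 + f 2 * u 1 + f 3 * u 2 + f 4 * u 3)
  -- For `κ = linContract x y ν` the recursion `κⱼ₊₁ = uⱼ + t κⱼ` expresses every entry by `κ₀` and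
  -- `u`; substituting it in `∑ fⱼ κⱼ = 0` gives the relation with `c = κ₀`, where `c` does not
  -- depend on `f`.
  have hrel : ∀ t, ∃ c : ℂ, ∀ f ∈ Z, c * (pol f).eval t + (res f).eval t = 0 := by
    intro t
    obtain ⟨ν, hν, hνu⟩ := hu t
    refine ⟨linContract x y ν 0, fun f hf => ?_⟩
    have h0 : linContract x y ν 1 = u 0 + t * linContract x y ν 0 := by
      rw [← hνu]; simp [affContract]
    have h1 : linContract x y ν 2 = u 1 + t * linContract x y ν 1 := by
      rw [← hνu]; simp [affContract]
    have h2 : linContract x y ν 3 = u 2 + t * linContract x y ν 2 := by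
      rw [← hνu]; simp [affContract]
    have h3 : linContract x y ν 4 = u 3 + t * linContract x y ν 3 := by
      rw [← hνu]; simp [affContract]
    have h := hf (linContract x y ν) ⟨ν, hν, rfl⟩
    rw [Fin.sum_univ_five, h3, h2, h1, h0] at h
    simp only [pol, res, Polynomial.eval_add, Polynomial.eval_mul, Polynomial.eval_C,
      Polynomial.eval_pow, Polynomial.eval_X]
    linear_combination h
  have hcross : ∀ f ∈ Z, ∀ g ∈ Z, pol f * res g = pol g * res f := by
    intro f hf g hg
    refine Polynomial.funext fun t => ?_
    obtain ⟨c, hc⟩ := hrel t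
    rw [Polynomial.eval_mul, Polynomial.eval_mul]
    linear_combination (pol f).eval t * hc g hg - (pol g).eval t * hc f hf
  -- The quartics in `Z` have no common zero at infinity: evaluation there is `Pi.single 4 1`, which
  -- separation keeps out of `K.map lin`. The next claim says the same of the finite point `[r :
  -- 1]`, where evaluation is `(rʲ)ⱼ`.
  obtain ⟨f, hf, hf4⟩ : ∃ f ∈ Z, f 4 ≠ 0 := by
    obtain ⟨f, hf, h⟩ := hZ (Pi.single 4 1) (by
      rintro ⟨ν, hν, hνe⟩
      have hνe : linContract x y ν = Pi.single 4 1 := hνe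
      have h0 := hK.eq_zero_of_linContract_eq_zero hν hxy fun j => by
        rw [hνe]; fin_cases j <;> simp
      have h1 := congrFun hνe 4
      rw [h0] at h1
      simp [linContract] at h1)
    exact ⟨f, hf, by simpa [Pi.single_apply] using h⟩
  have hroot : ∀ r, ∃ g ∈ Z, (pol g).eval r ≠ 0 := by
    intro r
    obtain ⟨g, hg, h⟩ := hZ (fun j => r ^ (j : ℕ)) (by
      rintro ⟨ν, hν, hνe⟩
      have hνe : linContract x y ν = fun j : Fin 5 => r ^ (j : ℕ) := hνe
      have h0 := hK.eq_zero_of_affContract_eq_zero (t := r) hν hxy (by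
        rw [hνe]; ext j; simp [affContract, pow_succ]; ring)
      have h1 := congrFun hνe 0
      rw [h0] at h1
      simp [linContract] at h1)
    refine ⟨g, hg, fun h0 => h ?_⟩
    rw [Fin.sum_univ_five, ← h0]
    simp [pol]
    ring
  have hI : Ideal.span (pol '' Z) = ⊤ := by
    set I := Ideal.span (pol '' Z)
    set d := Submodule.IsPrincipal.generator I
    have hd : Ideal.span {d} = I := Ideal.span_singleton_generator I
    by_cases hdeg : d.degree = 0
    · rw [← hd, Ideal.span_singleton_eq_top]
      exact Polynomial.isUnit_iff_degree_eq_zero.2 hdeg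
    · exfalso
      obtain ⟨r, hr⟩ := IsAlgClosed.exists_root d hdeg
      obtain ⟨g, hg, hgr⟩ := hroot r
      have hmem : pol g ∈ I := Ideal.subset_span ⟨g, hg, rfl⟩
      rw [← hd, Ideal.mem_span_singleton] at hmem
      obtain ⟨e, he⟩ := hmem
      exact hgr (by rw [he, Polynomial.eval_mul, hr.eq_zero, zero_mul])
  -- By `hcross`, `pol f` divides `pol g * res f` for all `g ∈ Z`, and the polynomials `pol g`
  -- generate the unit ideal. As `res f` has degree less than `4 = deg (pol f)`, it must vanish, and
  -- its coefficients then give `u = 0` successively.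
  have hdvd : pol f ∣ res f := by
    have hle : Ideal.span (pol '' Z) ≤
        Submodule.comap (LinearMap.mulRight (Polynomial ℂ) (res f)) (Ideal.span {pol f}) := by
      rw [Ideal.span, Submodule.span_le]
      rintro _ ⟨g, hg, rfl⟩
      change pol g * res f ∈ Ideal.span {pol f}
      rw [← hcross f hf g hg]
      exact Ideal.mem_span_singleton.2 (dvd_mul_right _ _)
    have h1 : (1 : Polynomial ℂ) ∈ Ideal.span (pol '' Z) := by rw [hI]; trivial
    have h2 : 1 * res f ∈ Ideal.span {pol f} := hle h1
    rwa [one_mul, Ideal.mem_span_singleton] at h2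
  have hdegf : (pol f).degree = 4 := by
    have hlt : (Polynomial.C (f 3) * Polynomial.X ^ 3 + Polynomial.C (f 2) * Polynomial.X ^ 2 +
      Polynomial.C (f 1) * Polynomial.X + Polynomial.C (f 0)).degree < 4 :=
      Polynomial.degree_cubic_lt
    have h4 : (Polynomial.C (f 4) * Polynomial.X ^ 4).degree = 4 :=
      Polynomial.degree_C_mul_X_pow 4 hf4
    rw [← h4] at hlt
    rw [← h4]
    exact Polynomial.degree_add_eq_left_of_degree_lt hlt
  have hres : res f = 0 := Polynomial.eq_zero_of_dvd_of_degree_lt hdvd (by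
    rw [hdegf]; exact Polynomial.degree_cubic_lt)
  have hc : (⟨f 4 * u 0, f 3 * u 0 + f 4 * u 1, f 2 * u 0 + f 3 * u 1 + f 4 * u 2,
      f 1 * u 0 + f 2 * u 1 + f 3 * u 2 + f 4 * u 3⟩ : Cubic ℂ) = ⟨0, 0, 0, 0⟩ :=
    (Cubic.toPoly_eq_zero_iff _).1 hres
  rw [Cubic.mk.injEq] at hc
  obtain ⟨c0, c1, c2, c3⟩ := hc
  have c0 : u 0 = 0 := by simpa [hf4] using c0
  have c1 : u 1 = 0 := by simpa [hf4, c0] using c1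
  have c2 : u 2 = 0 := by simpa [hf4, c0, c1] using c2
  have c3 : u 3 = 0 := by simpa [hf4, c0, c1, c2] using c3
  ext j
  fin_cases j <;> simp [c0, c1, c2, c3]

/-- A linear system of binary quintics which embeds `ℙ¹` has at least four members. -/
theorem finrank_le_two : Module.finrank ℂ K ≤ 2 := by
  by_contra hlt
  obtain ⟨b, hb⟩ := exists_linearIndependent_of_le_finrank (R := ℂ) (M := K) (n := 3) (by omega)
  set ν : Fin 3 → Fin 6 → ℂ := fun i => (b i : Fin 6 → ℂ) with hν
  have hνi : LinearIndependent ℂ ν := hb.map' K.subtype (Submodule.ker_subtype K)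
  obtain ⟨x, y, hxy, u, hu, h⟩ := exists_forall_sum_contractMinor_eq_zero ν
  refine hu (hK.eq_zero_of_forall_exists_affContract hxy fun t => ?_)
  set M : Matrix (Fin 4) (Fin 4) ℂ :=
    Matrix.of (Fin.cons u fun i : Fin 3 => affContract t (linContract x y (ν i))) with hM
  -- Expansion along the row `u` turns the relation between the minors into a linear dependence. The
  -- coefficient of `u` in it is nonzero because, by separation, the three contracted functionals
  -- are independent; so `u` is itself a contraction of a member of `K`.
  have hdet : M.det = 0 := by
    rw [Matrix.det_succ_row_zero, ← h t]
    refine Finset.sum_congr rfl fun j _ => ?_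
    rfl
  obtain ⟨v, hv, hv0⟩ := Matrix.exists_vecMul_eq_zero_iff.2 hdet
  have hsum : ∀ j, v 0 * u j +
      ∑ i : Fin 3, v i.succ * affContract t (linContract x y (ν i)) j = 0 := by
    intro j
    have := congrFun hv0 j
    simpa [Matrix.vecMul, dotProduct, Fin.sum_univ_succ, hM] using this
  have hlin : ∀ (w : Fin 3 → ℂ) j, affContract t (linContract x y (∑ i, w i • ν i)) j =
      ∑ i : Fin 3, w i * affContract t (linContract x y (ν i)) j := by
    intro w j
    simp only [affContract, linContract, Fin.sum_univ_three, Pi.add_apply, Pi.smul_apply,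
      smul_eq_mul]
    ring
  have hmem : ∀ w : Fin 3 → ℂ, ∑ i, w i • ν i ∈ K := fun w =>
    Submodule.sum_mem _ fun i _ => Submodule.smul_mem _ _ (b i).2
  have hv00 : v 0 ≠ 0 := by
    intro h0
    have h1 := hK.eq_zero_of_affContract_eq_zero (t := t) (hmem fun i => v i.succ) hxy (by
      ext j
      rw [hlin, Pi.zero_apply, ← hsum j, h0, zero_mul, zero_add])
    have h2 := Fintype.linearIndependent_iff.1 hνi _ h1
    apply hv
    ext i
    induction i using Fin.cases with
    | zero => exact h0
    | succ i => exact h2 i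
  refine ⟨∑ i, (-(v 0)⁻¹ * v i.succ) • ν i, hmem _, ?_⟩
  ext j
  rw [hlin]
  have := hsum j
  simp only [mul_assoc, ← Finset.mul_sum]
  rw [eq_neg_of_add_eq_zero_right this]
  field_simp

end IsSeparating

namespace SmoothRationalCurve

variable (C : SmoothRationalCurve 3 5)

theorem finrank_ker_spanMap : Module.finrank ℂ (LinearMap.ker C.spanMap) = 2 := by
  refine le_antisymm C.isSeparating_ker_spanMap.finrank_le_two ?_
  have h1 := LinearMap.finrank_range_add_finrank_ker C.spanMap
  have h2 := Submodule.finrank_le (LinearMap.range C.spanMap)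
  simp only [Module.finrank_fin_fun] at h1 h2
  omega

theorem spanMap_surjective : Function.Surjective C.spanMap := by
  rw [← LinearMap.range_eq_top]
  apply Submodule.eq_top_of_finrank_eq
  have h1 := LinearMap.finrank_range_add_finrank_ker C.spanMap
  rw [finrank_ker_spanMap] at h1
  simp only [Module.finrank_fin_fun] at h1 ⊢
  omega

end SmoothRationalCurve

end

noncomputable section

/-! ### Polynomial families of trisecant lines -/

/-- A kernel vector of the surjective value at `0` of a polynomial matrix extends to a polynomial
kernel vector. -/
theorem exists_polynomial_mulVec_eq_zero {r s : ℕ} (A : Matrix (Fin r) (Fin s) (Polynomial ℂ))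
    (h : Function.Surjective (A.map (Polynomial.eval 0)).mulVec) {e₀ : Fin s → ℂ}
    (h₀ : (A.map (Polynomial.eval 0)).mulVec e₀ = 0) :
    ∃ e : Fin s → Polynomial ℂ, A.mulVec e = 0 ∧ ∀ i, (e i).eval 0 = e₀ i := by
  obtain ⟨B, hB⟩ := Matrix.mulVec_surjective_iff_exists_right_inverse.1 h
  set B' := B.map (Polynomial.C : ℂ →+* Polynomial ℂ)
  set M := A * B'
  set e' : Fin s → Polynomial ℂ := fun i => Polynomial.C (e₀ i)
  set ev : Polynomial ℂ →+* ℂ := Polynomial.evalRingHom 0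
  have hB' : B'.map ev = B := by
    ext i j; simp [B', ev]
  have hA' : A.map ev = A.map (Polynomial.eval 0) := rfl
  have hM : M.map ev = 1 := by
    rw [Matrix.map_mul, hB', hA', hB]
  have hdet : ev M.det = 1 := by
    rw [RingHom.map_det, RingHom.mapMatrix_apply, hM, Matrix.det_one]
  have hAe : ∀ i, ev (A.mulVec e' i) = 0 := by
    intro i
    rw [RingHom.map_mulVec]
    have : ev ∘ e' = e₀ := by funext j; simp [e', ev]
    rw [this]
    exact congrFun h₀ i
  -- With `M = A B'` and `M adj(M) = det M`, applying `A` gives zero. At `0`, `det M = 1` and `A e'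
  -- = 0`, so the value is `e₀`.
  refine ⟨M.det • e' - B'.mulVec (M.adjugate.mulVec (A.mulVec e')), ?_, ?_⟩
  · rw [Matrix.mulVec_sub, Matrix.mulVec_smul, Matrix.mulVec_mulVec, Matrix.mulVec_mulVec,
      Matrix.mul_adjugate, Matrix.smul_mulVec, Matrix.one_mulVec, sub_self]
  · intro i
    change ev _ = _
    have h1 : ev ∘ (M.adjugate.mulVec (A.mulVec e')) = 0 := by
      funext j
      rw [Function.comp_apply, RingHom.map_mulVec]
      have : ev ∘ (A.mulVec e') = 0 := funext hAe
      rw [this, Matrix.mulVec_zero]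
    rw [Pi.sub_apply, map_sub, RingHom.map_mulVec, h1, Matrix.mulVec_zero, Pi.zero_apply, sub_zero,
      Pi.smul_apply, smul_eq_mul, map_mul, hdet, one_mul]
    simp [e', ev]

/-- The Hankel matrix of `ν + t μ` is polynomial in `t` and surjective at `t = 0`, so its kernel
vector `g₀` extends. -/
theorem IsSeparating.exists_polynomial_cubic {K : Submodule ℂ (Fin 6 → ℂ)} (hK : IsSeparating K)
    {ν : Fin 6 → ℂ} (hν : ν ∈ K) (hν0 : ν ≠ 0) (μ : Fin 6 → ℂ) {g₀ : Fin 4 → ℂ}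
    (hg₀ : ν ∈ annihilator (k := 3) 2 g₀) :
    ∃ g : Fin 4 → Polynomial ℂ, (∀ i, (g i).eval 0 = g₀ i) ∧
      ∀ t : ℂ, ν + t • μ ∈ annihilator (k := 3) 2 fun i => (g i).eval t := by
  set N : Fin 6 → Polynomial ℂ := fun l => Polynomial.C (ν l) + Polynomial.X * Polynomial.C (μ l)
  set A : Matrix (Fin 3) (Fin 4) (Polynomial ℂ) := Matrix.of fun i j => extendZero N ((i : ℕ) + j)
  have hN : ∀ t, (fun l => Polynomial.evalRingHom t (N l)) = ν + t • μ := by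
    intro t; funext l; simp [N]; ring
  have hA : ∀ g, (A.map (Polynomial.eval 0)).mulVec g = hankel ν g := by
    intro g
    ext i
    rw [hankel_apply, contract_apply (k := 3), Matrix.mulVec, dotProduct]
    refine Finset.sum_congr rfl fun j _ => ?_
    rw [mul_comm]
    congr 1
    change Polynomial.evalRingHom 0 (extendZero N ((i : ℕ) + j)) = _
    rw [map_extendZero, hN, zero_smul, add_zero]
  obtain ⟨g, hg, hg0⟩ := exists_polynomial_mulVec_eq_zero A (e₀ := g₀) (by
    intro w
    obtain ⟨g, hg⟩ := hK.hankel_surjective hν hν0 w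
    exact ⟨g, by rw [hA, hg]⟩) (by rw [hA]; exact hankel_eq_zero_iff.2 hg₀)
  refine ⟨g, hg0, fun t => mem_annihilator.2 ?_⟩
  ext i
  rw [← hN t]
  change contract (k := 3) 2 (fun j => Polynomial.evalRingHom t (g j)) _ i = 0
  rw [← map_contract (k := 3)]
  have : contract (k := 3) 2 g N i = A.mulVec g i := by
    rw [contract_apply (k := 3), Matrix.mulVec, dotProduct]
    exact Finset.sum_congr rfl fun j _ => mul_comm _ _
  rw [this, hg, Pi.zero_apply, map_zero]

/-- Here the polynomial matrix is contraction with `g`, surjective at `t = 0` because `g₀ ≠ 0`. -/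
theorem exists_polynomial_mem_annihilator {g : Fin 4 → Polynomial ℂ} {g₀ : Fin 4 → ℂ}
    (hg : ∀ i, (g i).eval 0 = g₀ i) (hg₀ : g₀ ≠ 0) {α : Fin 6 → ℂ}
    (hα : α ∈ annihilator (k := 3) 2 g₀) :
    ∃ a : Fin 6 → Polynomial ℂ, (∀ i, (a i).eval 0 = α i) ∧
      ∀ t : ℂ, (fun l => (a l).eval t) ∈ annihilator (k := 3) 2 fun i => (g i).eval t := by
  set A : Matrix (Fin 3) (Fin 6) (Polynomial ℂ) := LinearMap.toMatrix' (contract (k := 3) 2 g)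
  have hA : ∀ ν, (A.map (Polynomial.eval 0)).mulVec ν = contract (k := 3) 2 g₀ ν := by
    intro ν
    rw [← LinearMap.toMatrix'_mulVec]
    congr 1
    ext i l
    have hs : (fun j => Polynomial.evalRingHom 0 ((Pi.single l 1 : Fin 6 → Polynomial ℂ) j)) =
        Pi.single l 1 := by
      funext j
      simp only [Pi.single_apply]
      split <;> simp
    have hg' : (fun j => Polynomial.evalRingHom 0 (g j)) = g₀ := funext hg
    rw [Matrix.map_apply, LinearMap.toMatrix'_apply]
    change Polynomial.evalRingHom 0 (LinearMap.toMatrix' (contract (k := 3) 2 g) i l) = _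
    rw [LinearMap.toMatrix'_apply, map_contract (k := 3), hs, hg']
  obtain ⟨a, ha, ha0⟩ := exists_polynomial_mulVec_eq_zero A (e₀ := α) (by
    intro w
    obtain ⟨g, hg⟩ := contract_surjective (k := 3) (m := 2) rfl hg₀ w
    exact ⟨g, by rw [hA, hg]⟩) (by rw [hA]; exact mem_annihilator.1 hα)
  refine ⟨a, ha0, fun t => mem_annihilator.2 ?_⟩
  ext i
  change contract (k := 3) 2 (fun j => Polynomial.evalRingHom t (g j))
    (fun l => Polynomial.evalRingHom t (a l)) i = 0
  rw [← map_contract (k := 3), ← LinearMap.toMatrix'_mulVec, ha, Pi.zero_apply, map_zero]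

theorem linearIndependent_of_pluecker_ne_zero {n : ℕ} {v w : Fin (n + 1) → ℂ}
    {p : Fin (n + 1) × Fin (n + 1)} (h : LineIn.pluecker v w p ≠ 0) :
    LinearIndependent ℂ ![v, w] := by
  rw [LinearIndependent.pair_iff]
  intro s t hst
  have h1 := congrFun hst p.1
  have h2 := congrFun hst p.2
  simp only [Pi.add_apply, Pi.smul_apply, smul_eq_mul, Pi.zero_apply] at h1 h2
  have hs : s * LineIn.pluecker v w p = 0 := by
    rw [LineIn.pluecker]; linear_combination w p.2 * h1 - w p.1 * h2
  have ht : t * LineIn.pluecker v w p = 0 := by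
    rw [LineIn.pluecker]; linear_combination v p.1 * h2 - v p.2 * h1
  exact ⟨(mul_eq_zero.1 hs).resolve_right h, (mul_eq_zero.1 ht).resolve_right h⟩

theorem exists_pluecker_ne_zero {n : ℕ} {v w : Fin (n + 1) → ℂ}
    (h : LinearIndependent ℂ ![v, w]) : ∃ p, LineIn.pluecker v w p ≠ 0 := by
  by_contra! h0
  have hv : v ≠ 0 := h.ne_zero 0
  obtain ⟨i, hi⟩ := Function.ne_iff.1 hv
  have hi : v i ≠ 0 := hi
  refine (LinearIndependent.pair_iff' hv).1 h (w i / v i) ?_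
  funext j
  have := h0 (i, j)
  simp only [LineIn.pluecker] at this
  simp only [Pi.smul_apply, smul_eq_mul]
  field_simp
  linear_combination -this

namespace SmoothRationalCurve

section

variable {n : ℕ} (C : SmoothRationalCurve n 5)

/-- The trisecant lines which come from a functional `ν` in the kernel of the span map. -/
def trisecantsOf (ν : Fin 6 → ℂ) : Set (LineIn n) :=
  {L | ∃ g : Fin 4 → ℂ, g ≠ 0 ∧ ν ∈ annihilator (k := 3) 2 g ∧
    L.1 = (annihilator (k := 3) 2 g).map C.spanMap}

theorem trisecantsOf_subsingleton {ν : Fin 6 → ℂ} (hν : C.spanMap ν = 0) (h0 : ν ≠ 0) :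
    (C.trisecantsOf ν).Subsingleton := by
  rintro L ⟨g, hg, h, hL⟩ M ⟨g', hg', h', hM⟩
  apply Subtype.ext
  rw [hL, hM, C.isSeparating_ker_spanMap.annihilator_eq_of_mem hν h0 hg hg' h h']

theorem trisecantsOf_smul {ν : Fin 6 → ℂ} {a : ℂ} (ha : a ≠ 0) :
    C.trisecantsOf (a • ν) = C.trisecantsOf ν := by
  simp only [trisecantsOf, Submodule.smul_mem_iff _ ha]

theorem exists_mem_trisecantsOf_iff (L : LineIn n) :
    C.IsSecant 3 L ↔ ∃ ν : Fin 6 → ℂ, ν ≠ 0 ∧ C.spanMap ν = 0 ∧ L ∈ C.trisecantsOf ν :=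
  C.isSecant_three_iff L

end

variable (C : SmoothRationalCurve 3 5)

theorem exists_pencil {ν : Fin 6 → ℂ} (hν : C.spanMap ν = 0) (h0 : ν ≠ 0) :
    ∃ μ : Fin 6 → ℂ, C.spanMap μ = 0 ∧ LinearIndependent ℂ ![ν, μ] ∧
      ∀ κ, C.spanMap κ = 0 → ∃ a b : ℂ, κ = a • ν + b • μ := by
  have hf := C.finrank_ker_spanMap
  obtain ⟨⟨μ, hμ⟩, hli⟩ := exists_linearIndependent_pair_of_one_lt_finrank
    (R := ℂ) (M := LinearMap.ker C.spanMap) (by omega) (x := ⟨ν, hν⟩)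
    (fun h => h0 (congrArg Subtype.val h))
  have hspan := hli.span_eq_top_of_card_eq_finrank (by simp [hf])
  refine ⟨μ, hμ, ?_, fun κ hκ => ?_⟩
  · rw [LinearIndependent.pair_iff] at hli ⊢
    intro s t hst
    exact hli s t (Subtype.ext hst)
  · have hmem : (⟨κ, hκ⟩ : LinearMap.ker C.spanMap) ∈ Submodule.span ℂ
        (Set.range ![(⟨ν, hν⟩ : LinearMap.ker C.spanMap), ⟨μ, hμ⟩]) := by
      rw [hspan]; trivial
    rw [Matrix.range_cons_cons_empty, Submodule.mem_span_pair] at hmem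
    obtain ⟨a, b, hab⟩ := hmem
    exact ⟨a, b, (congrArg Subtype.val hab).symm⟩

theorem add_smul_ne_zero_of_linearIndependent {ν μ : Fin 6 → ℂ}
    (h : LinearIndependent ℂ ![ν, μ]) (t : ℂ) : ν + t • μ ≠ 0 := by
  intro h0
  have := LinearIndependent.pair_iff.1 h 1 t (by rw [one_smul, h0])
  exact one_ne_zero this.1

/-- A form which vanishes at infinitely many trisecant lines vanishes at all of them. -/
theorem vanishes_of_infinite {F : MvPolynomial (Fin 4 × Fin 4) ℂ}
    {Z : Set (LineIn 3)} (hZS : Z ⊆ C.secantLines 3) (hZ : Z.Infinite)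
    (hF : ∀ L ∈ Z, LineIn.Vanishes F L) {L₀ : LineIn 3} (hL₀ : C.IsSecant 3 L₀) :
    LineIn.Vanishes F L₀ := by
  obtain ⟨ν, hν0, hν, g₀, hg₀, hνg, hLg⟩ := (C.isSecant_three_iff L₀).1 hL₀
  obtain ⟨μ, hμ, hli, hspan⟩ := C.exists_pencil hν hν0
  have hKt : ∀ t : ℂ, C.spanMap (ν + t • μ) = 0 := fun t => by
    rw [map_add, map_smul, hν, hμ, smul_zero, add_zero]
  have hne := add_smul_ne_zero_of_linearIndependent hli
  have hμ0 : μ ≠ 0 := hli.ne_zero 1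
  set τ : Set ℂ := {t | ∃ L ∈ Z, L ∈ C.trisecantsOf (ν + t • μ)} with hτ
  -- Up to scalars every element of the kernel is some `ν + t μ` or `μ` itself, and each of them
  -- carries at most one trisecant line.
  have hτinf : τ.Infinite := by
    intro hfin
    refine hZ (Set.Finite.subset ((hfin.biUnion fun t _ =>
      (C.trisecantsOf_subsingleton (hKt t) (hne t)).finite).union
      (C.trisecantsOf_subsingleton hμ hμ0).finite) ?_)
    intro L hL
    obtain ⟨κ, hκ0, hκ, hLκ⟩ := (C.exists_mem_trisecantsOf_iff L).1 (hZS hL)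
    obtain ⟨a, b, rfl⟩ := hspan κ hκ
    by_cases ha : a = 0
    · right
      subst ha
      rw [zero_smul, zero_add] at hLκ hκ0
      rwa [C.trisecantsOf_smul (by rintro rfl; simp at hκ0)] at hLκ
    · left
      have e : a • ν + b • μ = a • (ν + (b / a) • μ) := by
        rw [smul_add, smul_smul, mul_div_cancel₀ _ ha]
      rw [e, C.trisecantsOf_smul ha] at hLκ
      exact Set.mem_biUnion ⟨L, hL, hLκ⟩ hLκ
  intro v hv w hw hvw
  rw [hLg] at hv hw
  obtain ⟨α, hα, rfl⟩ := hv
  obtain ⟨β, hβ, rfl⟩ := hw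
  obtain ⟨g, hg, hgt⟩ := C.isSeparating_ker_spanMap.exists_polynomial_cubic hν hν0 μ hνg
  obtain ⟨a, ha, hat⟩ := exists_polynomial_mem_annihilator hg hg₀ hα
  obtain ⟨b, hb, hbt⟩ := exists_polynomial_mem_annihilator hg hg₀ hβ
  obtain ⟨p, hp⟩ := exists_pluecker_ne_zero hvw
  obtain ⟨k, hk⟩ := Function.ne_iff.1 hg₀
  let T : (Fin 6 → Polynomial ℂ) → Fin 4 → Polynomial ℂ := fun x i =>
    ∑ l, Polynomial.C (C.coeffs i l) * x l
  have hT : ∀ x t i, (T x i).eval t = C.spanMap (fun l => (x l).eval t) i := by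
    intro x t i
    simp [T, spanMap_apply, Polynomial.eval_finsetSum]
  let P : Fin 4 × Fin 4 → Polynomial ℂ := fun p => T a p.1 * T b p.2 - T a p.2 * T b p.1
  have hP : ∀ t, (fun p => (P p).eval t) = LineIn.pluecker
      (C.spanMap fun l => (a l).eval t) (C.spanMap fun l => (b l).eval t) := by
    intro t
    funext p
    simp [P, hT, LineIn.pluecker]
  have ha' : (fun l => (a l).eval 0) = α := funext ha
  have hb' : (fun l => (b l).eval 0) = β := funext hb
  have hQ : ∀ t, (aeval P F).eval t = eval (fun p => (P p).eval t) F := by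
    intro t
    rw [← Polynomial.coe_evalRingHom, MvPolynomial.aeval_def, MvPolynomial.hom_eval₂]
    change _ = eval₂ (RingHom.id ℂ) _ F
    congr 1
    ext z
    simp
  -- The extra factors absorb the parameters at which the cubic may vanish or the two spanning
  -- vectors may become dependent. Both are nonzero at `t = 0`, so they cancel.
  have hzero : aeval P F * P p * g k = 0 := by
    refine Polynomial.eq_zero_of_infinite_isRoot _ (hτinf.mono ?_)
    rintro t ⟨L, hLZ, g', hg', hg't, hL⟩
    change Polynomial.eval t _ = 0
    rw [Polynomial.eval_mul, Polynomial.eval_mul]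
    by_cases hgk : (g k).eval t = 0
    · rw [hgk, mul_zero]
    have hgt0 : (fun i => (g i).eval t) ≠ 0 := fun h => hgk (congrFun h k)
    rw [C.isSeparating_ker_spanMap.annihilator_eq_of_mem (hKt t) (hne t) hgt0 hg' (hgt t) hg't]
      at hL
    by_cases hpt : (P p).eval t = 0
    · rw [hpt, mul_zero, zero_mul]
    rw [hQ, hP]
    have hpt' : LineIn.pluecker (C.spanMap fun l => (a l).eval t)
        (C.spanMap fun l => (b l).eval t) p ≠ 0 := by
      rw [← hP]; exact hpt
    rw [hF L hLZ _ (by rw [hL]; exact ⟨_, hat t, rfl⟩) _ (by rw [hL]; exact ⟨_, hbt t, rfl⟩)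
      (linearIndependent_of_pluecker_ne_zero hpt'), zero_mul, zero_mul]
  have hgk0 : g k ≠ 0 := fun h => hk (by rw [← hg k, h, Polynomial.eval_zero]; rfl)
  have hPp0 : P p ≠ 0 := fun h => hp (by
    have := congrFun (hP 0) p
    rw [ha', hb'] at this
    rw [← this, h, Polynomial.eval_zero])
  have h0 := ((mul_eq_zero.1 ((mul_eq_zero.1 hzero).resolve_right hgk0)).resolve_right hPp0)
  have h1 := hQ 0
  rw [h0, hP, ha', hb', Polynomial.eval_zero] at h1
  exact h1.symm

end SmoothRationalCurve

end

noncomputable section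

/-! ### The Zariski topology on the set of trisecant lines -/

section CofiniteTopology

variable {X : Type*} [TopologicalSpace X]

theorem IsIrreducible.subsingleton_of_finite [T1Space X] {s : Set X} (hs : IsIrreducible s)
    (hfin : s.Finite) : s.Subsingleton := by
  intro a ha b hb
  by_contra hab
  have hu : IsOpen (s \ {a})ᶜ := (hfin.subset Set.sdiff_subset).isClosed.isOpen_compl
  have hv : IsOpen ({a} : Set X)ᶜ := isClosed_singleton.isOpen_compl
  obtain ⟨c, hc, hcu, hcv⟩ := hs.2 _ _ hu hv ⟨a, ha, fun h => h.2 rfl⟩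
    ⟨b, hb, fun h => hab h.symm⟩
  exact hcu ⟨hc, hcv⟩

/-- An infinite `T₁` space whose proper closed subsets are finite has dimension one. -/
theorem topologicalKrullDim_eq_one_of_finite [T1Space X] [Infinite X]
    (h : ∀ s : Set X, IsClosed s → s.Finite ∨ s = Set.univ) : topologicalKrullDim X = 1 := by
  have hirr : IsIrreducible (Set.univ : Set X) := by
    refine ⟨Set.univ_nonempty, ?_⟩
    rintro u v hu hv ⟨a, -, ha⟩ ⟨b, -, hb⟩
    have hu' : uᶜ.Finite := (h _ hu.isClosed_compl).resolve_right fun h =>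
      (Set.eq_univ_iff_forall.1 h a) ha
    have hv' : vᶜ.Finite := (h _ hv.isClosed_compl).resolve_right fun h =>
      (Set.eq_univ_iff_forall.1 h b) hb
    obtain ⟨c, hc⟩ := (hu'.union hv').infinite_compl.nonempty
    rw [Set.compl_union, compl_compl, compl_compl] at hc
    exact ⟨c, trivial, hc⟩
  apply le_antisymm
  · rw [topologicalKrullDim, Order.krullDim_le_one_iff]
    intro x
    rcases h x.1 x.isClosed with hx | hx
    · left
      intro y hy
      have hsub := x.isIrreducible.subsingleton_of_finite hx
      obtain ⟨a, ha⟩ := y.isIrreducible.nonempty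
      intro b hb
      rw [hsub hb (hy ha)]
      exact ha
    · right
      intro y _ b _
      change b ∈ x.1
      rw [hx]; trivial
  · rw [topologicalKrullDim, Order.one_le_krullDim_iff]
    obtain ⟨a⟩ := (inferInstance : Nonempty X)
    refine ⟨⟨{a}, isIrreducible_singleton, isClosed_singleton⟩,
      ⟨Set.univ, hirr, isClosed_univ⟩, ?_⟩
    rw [lt_iff_le_not_ge]
    refine ⟨fun _ _ => trivial, fun hle => ?_⟩
    have hsub : (Set.univ : Set X) ⊆ {a} := hle
    exact Set.infinite_univ ((Set.finite_singleton a).subset hsub)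

end CofiniteTopology

theorem LineIn.isClosed_vanishes {n e : ℕ} {F : MvPolynomial (Fin (n + 1) × Fin (n + 1)) ℂ}
    (hF : F.IsHomogeneous e) : IsClosed {L : LineIn n | Vanishes F L} := by
  rw [← isOpen_compl_iff]
  exact TopologicalSpace.isOpen_generateFrom_of_mem ⟨F, e, hF, rfl⟩

theorem LineIn.exists_basis {n : ℕ} (L : LineIn n) :
    ∃ v w, v ∈ L.1 ∧ w ∈ L.1 ∧ LinearIndependent ℂ ![v, w] := by
  have h := L.2
  obtain ⟨b, hb⟩ := exists_linearIndependent_of_le_finrank (R := ℂ) (M := L.1) (n := 2) h.ge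
  refine ⟨b 0, b 1, (b 0).2, (b 1).2, ?_⟩
  have h2 : LinearIndependent ℂ (fun i => (b i : Fin (n + 1) → ℂ)) :=
    hb.map' L.1.subtype (Submodule.ker_subtype _)
  have e : (![(b 0 : Fin (n + 1) → ℂ), b 1]) = fun i => (b i : Fin (n + 1) → ℂ) := by
    funext i
    fin_cases i <;> rfl
  rw [e]
  exact h2

theorem LineIn.span_pair_eq {n : ℕ} (L : LineIn n) {v w : Fin (n + 1) → ℂ} (hv : v ∈ L.1)
    (hw : w ∈ L.1) (h : LinearIndependent ℂ ![v, w]) : Submodule.span ℂ {v, w} = L.1 := by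
  apply Submodule.eq_of_le_of_finrank_le
  · rw [Submodule.span_le]
    rintro x (rfl | rfl)
    · exact hv
    · exact hw
  · have := finrank_span_eq_card h
    rw [Matrix.range_cons_cons_empty] at this
    rw [L.2, this]
    simp

/-- The line `L` is cut out by linear equations in Plücker coordinates: contracting `v ∧ w` with `ℓ`
gives `ℓ(v) w - ℓ(w) v`, which is zero exactly when `ℓ` kills the line spanned by `v` and `w`. -/
instance LineIn.t1Space (n : ℕ) : T1Space (LineIn n) := by
  refine ⟨fun L => ?_⟩
  have heq : ({L} : Set (LineIn n)) = ⋂ ℓ ∈ L.1.dualAnnihilator, ⋂ j : Fin (n + 1),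
      {M | Vanishes (∑ i, C (ℓ (Pi.single i 1)) * X (i, j)) M} := by
    ext M
    simp only [Set.mem_singleton_iff, Set.mem_iInter]
    have hval : ∀ (ℓ : Module.Dual ℂ (Fin (n + 1) → ℂ)) j v w,
        eval (pluecker v w) (∑ i, C (ℓ (Pi.single i 1)) * X (i, j)) = ℓ v * w j - ℓ w * v j := by
      intro ℓ j v w
      rw [ℓ.apply_eq_sum v, ℓ.apply_eq_sum w]
      simp only [map_sum, map_mul, eval_C, eval_X, pluecker, Finset.sum_mul,
        ← Finset.sum_sub_distrib]
      exact Finset.sum_congr rfl fun i _ => by ring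
    constructor
    · rintro rfl ℓ hℓ j v hv w hw -
      rw [hval, (Submodule.mem_dualAnnihilator ℓ).1 hℓ v hv,
        (Submodule.mem_dualAnnihilator ℓ).1 hℓ w hw]
      ring
    · intro h
      obtain ⟨v, w, hv, hw, hvw⟩ := M.exists_basis
      have hmem : ∀ ℓ ∈ L.1.dualAnnihilator, ℓ v = 0 ∧ ℓ w = 0 := by
        intro ℓ hℓ
        have h1 := LinearIndependent.pair_iff.1 hvw (-ℓ w) (ℓ v) (by
          funext j
          have := h ℓ hℓ j v hv w hw hvw
          rw [hval] at this
          simp only [Pi.add_apply, Pi.smul_apply, smul_eq_mul, Pi.zero_apply]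
          linear_combination this)
        exact ⟨h1.2, neg_eq_zero.1 h1.1⟩
      have hLe : ∀ x, (∀ ℓ ∈ L.1.dualAnnihilator, ℓ x = 0) → x ∈ L.1 := by
        intro x hx
        rw [← Subspace.dualAnnihilator_dualCoannihilator_eq (W := L.1),
          Submodule.mem_dualCoannihilator]
        exact hx
      apply Subtype.ext
      rw [← M.span_pair_eq hv hw hvw,
        L.span_pair_eq (hLe v fun ℓ hℓ => (hmem ℓ hℓ).1) (hLe w fun ℓ hℓ => (hmem ℓ hℓ).2) hvw]
  rw [heq]
  refine isClosed_biInter fun ℓ _ => isClosed_iInter fun j => isClosed_vanishes (e := 1) ?_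
  exact IsHomogeneous.sum _ _ _ fun i _ => isHomogeneous_C_mul_X _ _

/-- A nonzero element of a unique factorization domain has, up to units, finitely many divisors. -/
theorem finite_divisors {R : Type*} [CommRing R] [IsDomain R] [UniqueFactorizationMonoid R]
    {f : R} (hf : f ≠ 0) : {d : Associates R | d ∣ Associates.mk f}.Finite := by
  have : Fintype {d : Associates R // d ∣ Associates.mk f} :=
    UniqueFactorizationMonoid.fintypeSubtypeDvd _ (Associates.mk_ne_zero.2 hf)
  exact Set.finite_coe_iff.1 (Finite.of_fintype {d : Associates R // d ∣ Associates.mk f})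

namespace SmoothRationalCurve

variable (C : SmoothRationalCurve 3 5)

theorem restrict_ne_zero {ℓ : Module.Dual ℂ (Fin 4 → ℂ)} (hℓ : ℓ ≠ 0) : C.restrict ℓ ≠ 0 := by
  rw [restrict_eq, Ne, binaryForm_eq_zero_iff]
  intro h
  apply hℓ
  refine LinearMap.ext fun v => ?_
  obtain ⟨ν, rfl⟩ := C.spanMap_surjective v
  rw [← sum_restrictCoeffs_mul, h]
  simp

theorem exists_dual_ne_zero (L : LineIn 3) : ∃ ℓ ∈ L.1.dualAnnihilator, ℓ ≠ 0 := by
  have hlt : L.1 < ⊤ := by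
    rw [lt_top_iff_ne_top]
    intro h
    have := L.2
    rw [h, finrank_top] at this
    simp at this
  obtain ⟨ℓ, h0, hle⟩ := Submodule.exists_le_ker_of_lt_top _ hlt
  exact ⟨ℓ, (Submodule.mem_dualAnnihilator ℓ).2 fun w hw => hle hw, h0⟩

theorem exists_mem_ker : ∃ ν : Fin 6 → ℂ, ν ≠ 0 ∧ C.spanMap ν = 0 := by
  have h : 0 < Module.finrank ℂ (LinearMap.ker C.spanMap) := by rw [C.finrank_ker_spanMap]; simp
  obtain ⟨⟨ν, hν⟩, h0⟩ := Module.finrank_pos_iff_exists_ne_zero.1 h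
  exact ⟨ν, fun h => h0 (Subtype.ext h), hν⟩

/-- If there were finitely many, one line `L₀` would serve infinitely many `ν + t μ`. Their cubics
all divide the restriction of a single linear form, a nonzero quintic with finitely many divisors up
to units. -/
theorem infinite_secantLines : (C.secantLines 3).Infinite := by
  intro hfin
  obtain ⟨ν, hν0, hν⟩ := C.exists_mem_ker
  obtain ⟨μ, hμ, hli, -⟩ := C.exists_pencil hν hν0
  have hKt : ∀ t : ℂ, C.spanMap (ν + t • μ) = 0 := fun t => by
    rw [map_add, map_smul, hν, hμ, smul_zero, add_zero]
  choose L hL g hg hgt hLg using fun t : ℂ =>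
    C.exists_isSecant_three (add_smul_ne_zero_of_linearIndependent hli t) (hKt t)
  have : Finite (C.secantLines 3) := hfin
  obtain ⟨⟨L₀, hL₀⟩, hinf⟩ := Finite.exists_infinite_fiber
    (fun t : ℂ => (⟨L t, hL t⟩ : C.secantLines 3))
  obtain ⟨ℓ, hℓ, hℓ0⟩ := exists_dual_ne_zero L₀
  have hdiv := finite_divisors (C.restrict_ne_zero hℓ0)
  set τ := (fun t : ℂ => (⟨L t, hL t⟩ : C.secantLines 3)) ⁻¹' {⟨L₀, hL₀⟩}
  have hτ : τ.Infinite := Set.infinite_coe_iff.1 hinf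
  -- Two parameters with associated cubics would put the whole pencil of `ν` and `μ` in one
  -- annihilator, against `finrank_inf_annihilator_le`.
  have hinj : Set.InjOn (fun t => Associates.mk (binaryForm 3 (g t))) τ := by
    intro s _ t _ hst
    have hst' := Associates.mk_eq_mk_iff_associated.1 hst
    by_contra hne
    have hle := annihilator_le_of_dvd (k := 3) (m := 2) (k' := 3) (m' := 2) rfl rfl hst'.dvd
    have h1 := hle (hgt s)
    have h2 := hgt t
    have hμg : μ ∈ annihilator (k := 3) 2 (g t) := by
      have h3 := Submodule.sub_mem _ h1 h2
      have e : ν + s • μ - (ν + t • μ) = (s - t) • μ := by rw [sub_smul]; abel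
      rw [e] at h3
      exact (Submodule.smul_mem_iff _ (sub_ne_zero.2 hne)).1 h3
    have hνg : ν ∈ annihilator (k := 3) 2 (g t) := by
      have h3 := Submodule.sub_mem _ h2 (Submodule.smul_mem _ t hμg)
      rwa [add_sub_cancel_right] at h3
    have hr := C.isSeparating_ker_spanMap.finrank_inf_annihilator_le (hg t)
    have h4 : Submodule.span ℂ (Set.range ![ν, μ]) ≤
        LinearMap.ker C.spanMap ⊓ annihilator (k := 3) 2 (g t) := by
      rw [Matrix.range_cons_cons_empty, Submodule.span_le]
      rintro x (rfl | rfl)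
      · exact ⟨hν, hνg⟩
      · exact ⟨hμ, hμg⟩
    have h5 := Submodule.finrank_mono h4
    rw [finrank_span_eq_card hli] at h5
    simp at h5
    omega
  refine (hτ.image hinj) (hdiv.subset ?_)
  rintro _ ⟨t, ht, rfl⟩
  have ht' : L t = L₀ := congrArg Subtype.val ht
  refine Associates.mk_dvd_mk.2 ?_
  refine (C.forall_dvd_restrict_iff (k := 3) (m := 2) rfl L₀ (g t)).2 ?_ ℓ hℓ
  rw [← ht', hLg t]

/-- A Zariski open set contains no trisecant line or all but finitely many of them. -/
theorem secantLines_inter_open {U : Set (LineIn 3)} (hU : IsOpen U) :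
    C.secantLines 3 ∩ U = ∅ ∨ (C.secantLines 3 \ U).Finite := by
  induction hU with
  | basic U hU =>
    obtain ⟨F, e, hF, rfl⟩ := hU
    by_cases hfin : (C.secantLines 3 \ {L | ¬ LineIn.Vanishes F L}).Finite
    · exact Or.inr hfin
    · left
      rw [Set.eq_empty_iff_forall_notMem]
      rintro L ⟨hL, hLF⟩
      exact hLF (C.vanishes_of_infinite Set.sdiff_subset hfin
        (fun M hM => not_not.1 hM.2) hL)
  | univ => right; simp
  | inter U V _ _ hU hV =>
    rcases hU with hU | hU
    · left
      rw [← Set.inter_assoc, hU, Set.empty_inter]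
    rcases hV with hV | hV
    · left
      rw [Set.inter_comm U, ← Set.inter_assoc, hV, Set.empty_inter]
    · right
      rw [Set.sdiff_inter]
      exact hU.union hV
  | sUnion s _ hs =>
    by_cases h : ∃ U ∈ s, (C.secantLines 3 \ U).Finite
    · obtain ⟨U, hU, hfin⟩ := h
      exact Or.inr (hfin.subset (Set.sdiff_subset_sdiff_right (Set.subset_sUnion_of_mem hU)))
    · left
      push Not at h
      rw [Set.eq_empty_iff_forall_notMem]
      rintro L ⟨hL, U, hU, hLU⟩
      exact Set.eq_empty_iff_forall_notMem.1 ((hs U hU).resolve_right (h U hU)) L ⟨hL, hLU⟩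

theorem isIrreducible_secantLines : IsIrreducible (C.secantLines 3) := by
  refine ⟨C.infinite_secantLines.nonempty, ?_⟩
  intro u v hu hv hSu hSv
  have hu' := (C.secantLines_inter_open hu).resolve_left hSu.ne_empty
  have hv' := (C.secantLines_inter_open hv).resolve_left hSv.ne_empty
  obtain ⟨L, hL, hLn⟩ := (C.infinite_secantLines.sdiff (hu'.union hv')).nonempty
  refine ⟨L, hL, ?_, ?_⟩
  · by_contra h
    exact hLn (Or.inl ⟨hL, h⟩)
  · by_contra h
    exact hLn (Or.inr ⟨hL, h⟩)

theorem topologicalKrullDim_secantLines : topologicalKrullDim (C.secantLines 3) = 1 := by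
  have : Infinite (C.secantLines 3) := C.infinite_secantLines.to_subtype
  refine topologicalKrullDim_eq_one_of_finite fun s hs => ?_
  obtain ⟨t, ht, rfl⟩ := isClosed_induced_iff.1 hs
  rcases C.secantLines_inter_open ht.isOpen_compl with h | h
  · right
    rw [Set.eq_univ_iff_forall]
    rintro ⟨L, hL⟩
    by_contra hLt
    exact Set.eq_empty_iff_forall_notMem.1 h L ⟨hL, hLt⟩
  · left
    refine Set.Finite.of_finite_image (f := Subtype.val) (h.subset ?_)
      Subtype.val_injective.injOn
    rintro _ ⟨⟨L, hL⟩, hLt, rfl⟩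
    exact ⟨hL, fun h => h hLt⟩

end SmoothRationalCurve

end

noncomputable section

/-! ### The set of trisecant lines is closed -/

/-- This is what remains after a common linear factor of the quadratic coefficients is cancelled. A
further common factor would make `f` and `f'` proportional; otherwise they share a quartic factor,
and a linear factor of it is dropped. -/
theorem exists_cubic_dvd_of_linear_relation {f f' b : MvPolynomial (Fin 2) ℂ}
    (hf' : f'.IsHomogeneous 5) (hli : LinearIndependent ℂ ![f, f']) {y : Fin 2 → ℂ} (hy : y ≠ 0)
    (hb : b.IsHomogeneous 1) (h : linForm y * f + b * f' = 0) :
    ∃ g : MvPolynomial (Fin 2) ℂ, g ≠ 0 ∧ g.IsHomogeneous 3 ∧ g ∣ f ∧ g ∣ f' := by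
  have hyy : eval y (linForm y) = 0 := by rw [eval_linForm]; ring
  have hf'0 : f' ≠ 0 := hli.ne_zero 1
  by_cases hby : eval y b = 0
  · exfalso
    obtain ⟨c, hc, rfl⟩ := exists_eq_linForm_mul (d := 0) hb hy hby
    have h1 : linForm y * (f + c * f') = 0 := by linear_combination h
    have h2 := (mul_eq_zero.1 h1).resolve_left (linForm_ne_zero hy)
    rw [totalDegree_eq_zero_iff_eq_C.1 (Nat.le_zero.1 hc.totalDegree_le)] at h2
    have h3 := LinearIndependent.pair_iff.1 hli 1 (coeff 0 c) (by
      rw [one_smul, smul_eq_C_mul, h2])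
    exact one_ne_zero h3.1
  · have h1 := congrArg (eval y) h
    rw [map_add, map_mul, map_mul, hyy, zero_mul, zero_add, map_zero] at h1
    obtain ⟨G, hG, rfl⟩ := exists_eq_linForm_mul (d := 4) hf' hy
      ((mul_eq_zero.1 h1).resolve_left hby)
    obtain ⟨z, hz, g, hg, rfl⟩ := exists_eq_linForm_mul_of_isHomogeneous (d := 3) hG
    have h2 : linForm y * (f + b * (linForm z * g)) = 0 := by linear_combination h
    have h3 := (mul_eq_zero.1 h2).resolve_left (linForm_ne_zero hy)
    refine ⟨g, ?_, hg, ⟨-b * linForm z, by linear_combination h3⟩,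
      ⟨linForm y * linForm z, by ring⟩⟩
    rintro rfl
    simp at hf'0

/-- Independent binary quintics `f`, `f'` with a relation `a f + b f' = 0`, `a` and `b` quadratic,
have a common cubic factor. -/
theorem exists_cubic_dvd_of_relation {f f' a b : MvPolynomial (Fin 2) ℂ}
    (hf' : f'.IsHomogeneous 5) (hli : LinearIndependent ℂ ![f, f'])
    (ha : a.IsHomogeneous 2) (hb : b.IsHomogeneous 2) (hab : a ≠ 0 ∨ b ≠ 0)
    (h : a * f + b * f' = 0) :
    ∃ g : MvPolynomial (Fin 2) ℂ, g ≠ 0 ∧ g.IsHomogeneous 3 ∧ g ∣ f ∧ g ∣ f' := by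
  have hf'0 : f' ≠ 0 := hli.ne_zero 1
  have ha0 : a ≠ 0 := by
    rintro rfl
    rw [zero_mul, zero_add] at h
    have := (mul_eq_zero.1 h).resolve_right hf'0
    simp [this] at hab
  obtain ⟨a, rfl⟩ := ha.exists_eq_binaryForm
  obtain ⟨x, y, hx, hy, hxy⟩ := exists_linForm_mul_linForm (q := a)
    (fun h => ha0 (by rw [h, binaryForm_zero]))
  have hxx : eval x (linForm x) = 0 := by rw [eval_linForm]; ring
  have hyy : eval y (linForm y) = 0 := by rw [eval_linForm]; ring
  rw [hxy] at h
  by_cases hbx : eval x b = 0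
  · obtain ⟨c, hc, rfl⟩ := exists_eq_linForm_mul (d := 1) hb hx hbx
    refine exists_cubic_dvd_of_linear_relation hf' hli hy hc ?_
    have h1 : linForm x * (linForm y * f + c * f') = 0 := by linear_combination h
    exact (mul_eq_zero.1 h1).resolve_left (linForm_ne_zero hx)
  by_cases hby : eval y b = 0
  · obtain ⟨c, hc, rfl⟩ := exists_eq_linForm_mul (d := 1) hb hy hby
    refine exists_cubic_dvd_of_linear_relation hf' hli hx hc ?_
    have h1 : linForm y * (linForm x * f + c * f') = 0 := by linear_combination h
    exact (mul_eq_zero.1 h1).resolve_left (linForm_ne_zero hy)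
  -- Now the coefficients are coprime, so the two linear factors of `a` can be divided out of `f'`
  -- one after the other; with cubic quotient `g`, `f = -b g`.
  have h1 := congrArg (eval x) h
  rw [map_add, map_mul, map_mul, map_mul, hxx, zero_mul, zero_mul, zero_add, map_zero] at h1
  obtain ⟨f₁, hf₁, rfl⟩ := exists_eq_linForm_mul (d := 4) hf' hx
    ((mul_eq_zero.1 h1).resolve_left hbx)
  have h2 : linForm x * (linForm y * f + b * f₁) = 0 := by linear_combination h
  have h3 := (mul_eq_zero.1 h2).resolve_left (linForm_ne_zero hx)
  have h4 := congrArg (eval y) h3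
  rw [map_add, map_mul, map_mul, hyy, zero_mul, zero_add, map_zero] at h4
  obtain ⟨g, hg, rfl⟩ := exists_eq_linForm_mul (d := 3) hf₁ hy
    ((mul_eq_zero.1 h4).resolve_left hby)
  have h5 : linForm y * (f + b * g) = 0 := by linear_combination h3
  have h6 := (mul_eq_zero.1 h5).resolve_left (linForm_ne_zero hy)
  refine ⟨g, ?_, hg, ⟨-b, by linear_combination h6⟩, ⟨linForm x * linForm y, by ring⟩⟩
  rintro rfl
  simp at hf'0

theorem eq_zero_of_forall_eval_eq_zero {d : ℕ} {f : MvPolynomial (Fin 2) ℂ}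
    (hf : f.IsHomogeneous d) (h : ∀ e : Fin (d + 1), eval ![((e : ℕ) : ℂ), 1] f = 0) : f = 0 := by
  obtain ⟨a, rfl⟩ := hf.exists_eq_binaryForm
  set p : Polynomial ℂ := ∑ j, Polynomial.C (a j) * Polynomial.X ^ (j : ℕ) with hp
  have hdeg : p.natDegree ≤ d := Polynomial.natDegree_sum_le_of_forall_le _ _ fun j _ =>
    (Polynomial.natDegree_C_mul_X_pow_le _ _).trans (Nat.lt_succ_iff.1 j.2)
  have hp0 : p = 0 := by
    refine Polynomial.eq_zero_of_natDegree_lt_card_of_eval_eq_zero p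
      (f := fun k : Fin (d + 1) => ((k : ℕ) : ℂ)) ?_ ?_ (by simpa using Nat.lt_succ_iff.2 hdeg)
    · intro k k' hk
      exact Fin.ext (Nat.cast_injective (R := ℂ) hk)
    · intro k
      have := h k
      rw [eval_binaryForm] at this
      simpa [hp, Polynomial.eval_finsetSum] using this
  rw [binaryForm_eq_zero_iff]
  funext j
  have hc : p.coeff j = a j := by
    rw [hp, Polynomial.finsetSum_coeff, Finset.sum_eq_single j]
    · simp
    · intro i _ hi
      rw [Polynomial.coeff_C_mul, Polynomial.coeff_X_pow, if_neg, mul_zero]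
      exact fun h => hi (Fin.ext h.symm)
    · simp
  rw [← hc, hp0, Polynomial.coeff_zero, Pi.zero_apply]

section Sylvester

variable {R S : Type*} [CommRing R] [CommRing S]

/-- The matrix of `(a, b) ↦ a f + b f'` for quadratic forms `a`, `b` and quintic forms `f`, `f'`;
forms of degree seven are given by their values at eight points. -/
def sylvesterMatrix (f f' : Fin 6 → R) : Matrix (Fin 8) (Fin 3 ⊕ Fin 3) R :=
  Matrix.of fun e => Sum.elim
    (fun i => ((e : ℕ) : R) ^ (i : ℕ) * ∑ l, f l * ((e : ℕ) : R) ^ (l : ℕ))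
    (fun i => ((e : ℕ) : R) ^ (i : ℕ) * ∑ l, f' l * ((e : ℕ) : R) ^ (l : ℕ))

/-- The matrix of dual Plücker coordinates. -/
def dualPluecker (p : Fin 4 × Fin 4 → R) : Matrix (Fin 4) (Fin 4) R :=
  !![0, p (2, 3), -p (1, 3), p (1, 2);
    -p (2, 3), 0, p (0, 3), -p (0, 2);
    p (1, 3), -p (0, 3), 0, p (0, 1);
    -p (1, 2), p (0, 2), -p (0, 1), 0]

end Sylvester

theorem sylvesterMatrix_mulVec (f f' : Fin 6 → ℂ) (a b : Fin 3 → ℂ) (e : Fin 8) :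
    (sylvesterMatrix f f').mulVec (Sum.elim a b) e =
      eval ![((e : ℕ) : ℂ), 1] (binaryForm 2 a * binaryForm 5 f +
        binaryForm 2 b * binaryForm 5 f') := by
  simp only [map_add, map_mul, eval_binaryForm, Matrix.mulVec, dotProduct, Fintype.sum_sum_type,
    sylvesterMatrix, Matrix.of_apply, Sum.elim_inl, Sum.elim_inr, Matrix.cons_val_zero,
    Matrix.cons_val_one, one_pow, mul_one, Finset.sum_mul]
  congr 1 <;> exact Finset.sum_congr rfl fun i _ => by ring

theorem dualPluecker_mul_eq_zero (v w : Fin 4 → ℂ) (k : Fin 4) :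
    ∑ i, dualPluecker (LineIn.pluecker (n := 3) v w) k i * v i = 0 ∧
      ∑ i, dualPluecker (LineIn.pluecker (n := 3) v w) k i * w i = 0 := by
  constructor <;> fin_cases k <;>
    simp [Fin.sum_univ_four, dualPluecker, LineIn.pluecker] <;> ring

/-- The matrix is antisymmetric and nonzero. If its entry `(k, l)` is nonzero, rows `k` and `l` are
independent, since their minor in columns `k`, `l` is the square of that entry. -/
theorem exists_dualPluecker_rows_linearIndependent {v w : Fin 4 → ℂ}
    (h : LinearIndependent ℂ ![v, w]) :
    ∃ k l, LinearIndependent ℂ ![dualPluecker (LineIn.pluecker (n := 3) v w) k,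
      dualPluecker (LineIn.pluecker (n := 3) v w) l] := by
  set Q := dualPluecker (LineIn.pluecker (n := 3) v w) with hQ
  have hdiag : ∀ k, Q k k = 0 := by
    intro k; fin_cases k <;> rfl
  have hanti : ∀ k l, Q l k = -Q k l := by
    intro k l
    fin_cases k <;> fin_cases l <;> simp [hQ, dualPluecker]
  suffices hne : ∃ k l, Q k l ≠ 0 by
    obtain ⟨k, l, hkl⟩ := hne
    refine ⟨k, l, linearIndependent_of_pluecker_ne_zero (n := 3) (p := (k, l)) ?_⟩
    simp only [LineIn.pluecker, hdiag, hanti k l]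
    simpa using hkl
  by_contra! h0
  obtain ⟨⟨i, j⟩, hp⟩ := exists_pluecker_ne_zero (n := 3) h
  have hp' : ∀ i j, LineIn.pluecker (n := 3) v w (i, j) =
      -LineIn.pluecker (n := 3) v w (j, i) := by
    intro i j; simp [LineIn.pluecker]
  have hself : ∀ i, LineIn.pluecker (n := 3) v w (i, i) = 0 := by
    intro i; simp [LineIn.pluecker]
  have h01 : LineIn.pluecker (n := 3) v w (0, 1) = 0 := h0 2 3
  have h02 : LineIn.pluecker (n := 3) v w (0, 2) = 0 := h0 3 1
  have h03 : LineIn.pluecker (n := 3) v w (0, 3) = 0 := h0 1 2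
  have h12 : LineIn.pluecker (n := 3) v w (1, 2) = 0 := h0 0 3
  have h13 : LineIn.pluecker (n := 3) v w (1, 3) = 0 := neg_eq_zero.1 (h0 0 2)
  have h23 : LineIn.pluecker (n := 3) v w (2, 3) = 0 := h0 0 1
  apply hp
  fin_cases i <;> fin_cases j <;>
    first
    | exact hself _
    | assumption
    | (rw [hp']; exact neg_eq_zero.2 (by assumption))

/-- The linear form with given coefficients. -/
def dualOfVec (c : Fin 4 → ℂ) : Module.Dual ℂ (Fin 4 → ℂ) :=
  ∑ i, c i • LinearMap.proj i

theorem dualOfVec_apply (c v : Fin 4 → ℂ) : dualOfVec c v = ∑ i, c i * v i := by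
  simp [dualOfVec]

theorem dualOfVec_single (c : Fin 4 → ℂ) (i : Fin 4) : dualOfVec c (Pi.single i 1) = c i := by
  simp [dualOfVec_apply, Pi.single_apply]

theorem span_dualOfVec_eq {L : LineIn 3} {v w : Fin 4 → ℂ} (hv : v ∈ L.1) (hw : w ∈ L.1)
    (hvw : LinearIndependent ℂ ![v, w]) {c c' : Fin 4 → ℂ} (hc : LinearIndependent ℂ ![c, c'])
    (hcv : ∑ i, c i * v i = 0) (hcw : ∑ i, c i * w i = 0)
    (hcv' : ∑ i, c' i * v i = 0) (hcw' : ∑ i, c' i * w i = 0) :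
    Submodule.span ℂ {dualOfVec c, dualOfVec c'} = L.1.dualAnnihilator := by
  have hmem : ∀ c : Fin 4 → ℂ, ∑ i, c i * v i = 0 → ∑ i, c i * w i = 0 →
      dualOfVec c ∈ L.1.dualAnnihilator := by
    intro c hcv hcw
    rw [Submodule.mem_dualAnnihilator]
    intro x hx
    rw [← L.span_pair_eq hv hw hvw, Submodule.mem_span_pair] at hx
    obtain ⟨s, t, rfl⟩ := hx
    rw [map_add, map_smul, map_smul, dualOfVec_apply, dualOfVec_apply, hcv, hcw]
    simp
  have hli : LinearIndependent ℂ ![dualOfVec c, dualOfVec c'] := by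
    rw [LinearIndependent.pair_iff] at hc ⊢
    intro s t hst
    refine hc s t (funext fun i => ?_)
    have := LinearMap.congr_fun hst (Pi.single i 1)
    simpa [dualOfVec_single] using this
  apply Submodule.eq_of_le_of_finrank_le
  · rw [Submodule.span_le]
    rintro x (rfl | rfl)
    · exact hmem c hcv hcw
    · exact hmem c' hcv' hcw'
  · have h1 := finrank_span_eq_card hli
    rw [Matrix.range_cons_cons_empty] at h1
    have h2 := Subspace.finrank_add_finrank_dualAnnihilator_eq L.1
    rw [L.2] at h2
    simp only [Module.finrank_fin_fun] at h2
    rw [h1, Fintype.card_fin]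
    exact (by omega : Module.finrank ℂ L.1.dualAnnihilator ≤ 2)

namespace SmoothRationalCurve

variable (C : SmoothRationalCurve 3 5)

/-- The coefficients of the restrictions to the curve of the four linear forms given by dual
Plücker coordinates. -/
def dualForms {R : Type*} [CommRing R] [Algebra ℂ R] (p : Fin 4 × Fin 4 → R) (k : Fin 4) :
    Fin 6 → R :=
  fun l => ∑ i, dualPluecker p k i * algebraMap ℂ R (C.coeffs i l)

theorem restrictCoeffs_dualOfVec (p : Fin 4 × Fin 4 → ℂ) (k : Fin 4) :
    C.restrictCoeffs (dualOfVec (dualPluecker p k)) = C.dualForms p k := by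
  funext l
  simp only [restrictCoeffs, dualForms, Algebra.algebraMap_self, RingHom.id_apply]
  exact Finset.sum_congr rfl fun i _ => congrArg (· * _) (dualOfVec_single _ i)

/-- The matrix whose minors are the equations of the set of trisecant lines. -/
def trisecantMatrix (ρ : Matrix (Fin 3 ⊕ Fin 3) (Fin 8) ℂ) (k l : Fin 4) :
    Matrix (Fin 3 ⊕ Fin 3) (Fin 3 ⊕ Fin 3) (MvPolynomial (Fin 4 × Fin 4) ℂ) :=
  Matrix.of fun i j => ∑ e, MvPolynomial.C (ρ i e) *
    sylvesterMatrix (C.dualForms X k) (C.dualForms X l) e j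

/-- The equations of the set of trisecant lines in Plücker coordinates. -/
def trisecantEquation (ρ : Matrix (Fin 3 ⊕ Fin 3) (Fin 8) ℂ) (k l : Fin 4) :
    MvPolynomial (Fin 4 × Fin 4) ℂ :=
  (C.trisecantMatrix ρ k l).det

theorem isHomogeneous_dualPluecker (k i : Fin 4) :
    (dualPluecker (X : Fin 4 × Fin 4 → MvPolynomial (Fin 4 × Fin 4) ℂ) k i).IsHomogeneous 1 := by
  fin_cases k <;> fin_cases i <;>
    first
    | exact isHomogeneous_zero _ _ _
    | exact isHomogeneous_X _ _
    | exact (isHomogeneous_X _ _).neg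

theorem isHomogeneous_trisecantEquation (ρ : Matrix (Fin 3 ⊕ Fin 3) (Fin 8) ℂ) (k l : Fin 4) :
    (C.trisecantEquation ρ k l).IsHomogeneous 6 := by
  have hform : ∀ k l, (C.dualForms X k l : MvPolynomial (Fin 4 × Fin 4) ℂ).IsHomogeneous 1 := by
    intro k l
    refine IsHomogeneous.sum _ _ _ fun i _ => ?_
    rw [mul_comm]
    exact (isHomogeneous_dualPluecker k i).C_mul _
  have hcast : ∀ (e : Fin 8) (j : ℕ), (((e : ℕ) : MvPolynomial (Fin 4 × Fin 4) ℂ) ^ j) =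
      MvPolynomial.C (((e : ℕ) : ℂ) ^ j) := by intro e j; simp
  have hS : ∀ e i, (sylvesterMatrix (C.dualForms X k) (C.dualForms X l) e i :
      MvPolynomial (Fin 4 × Fin 4) ℂ).IsHomogeneous 1 := by
    intro e i
    rcases i with i | i
    all_goals
      simp only [sylvesterMatrix, Matrix.of_apply, Sum.elim_inl, Sum.elim_inr, hcast]
      refine IsHomogeneous.C_mul (IsHomogeneous.sum _ _ _ fun j _ => ?_) _
      rw [mul_comm]
      exact (hform _ _).C_mul _
  rw [trisecantEquation, Matrix.det_apply]
  refine IsHomogeneous.sum _ _ _ fun σ _ => ?_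
  have hprod : (∏ i, C.trisecantMatrix ρ k l (σ i) i).IsHomogeneous 6 := by
    have h := IsHomogeneous.prod Finset.univ (fun i => C.trisecantMatrix ρ k l (σ i) i)
      (fun _ => 1) (fun i _ => by
        rw [trisecantMatrix, Matrix.of_apply]
        exact IsHomogeneous.sum _ _ _ fun e _ => (hS e i).C_mul _)
    simpa using h
  rcases Int.units_eq_one_or (Equiv.Perm.sign σ) with h | h
  · rw [h, one_smul]; exact hprod
  · rw [h, Units.neg_smul, one_smul]; exact hprod.neg

theorem eval_trisecantEquation (ρ : Matrix (Fin 3 ⊕ Fin 3) (Fin 8) ℂ) (k l : Fin 4)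
    (p : Fin 4 × Fin 4 → ℂ) :
    eval p (C.trisecantEquation ρ k l) =
      (ρ * sylvesterMatrix (C.dualForms p k) (C.dualForms p l)).det := by
  have hdual : ∀ k i, eval p (dualPluecker X k i) = dualPluecker p k i := by
    intro k i
    fin_cases k <;> fin_cases i <;> simp [dualPluecker]
  have hform : ∀ k l, eval p (C.dualForms X k l) = C.dualForms p k l := by
    intro k l
    simp [dualForms, hdual, MvPolynomial.algebraMap_eq]
  have hS : ∀ e i, eval p (sylvesterMatrix (C.dualForms X k) (C.dualForms X l) e i) =
      sylvesterMatrix (C.dualForms p k) (C.dualForms p l) e i := by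
    intro e i
    rcases i with i | i <;> simp [sylvesterMatrix, hform]
  rw [trisecantEquation, RingHom.map_det, RingHom.mapMatrix_apply]
  congr 1
  ext i j
  simp [trisecantMatrix, Matrix.mul_apply, hS]

/-- Two quintics spanning the restrictions of the linear forms through `L` have a common cubic
factor exactly when they satisfy a relation with quadratic coefficients, that is, when the `8 × 6`
matrix `sylvesterMatrix` is not injective. The determinants `det (ρ S)` for all `ρ` detect this,
since an injective `S` has a left inverse. -/
theorem isSecant_three_iff_vanishes (L : LineIn 3) :
    C.IsSecant 3 L ↔ ∀ ρ k l, LineIn.Vanishes (C.trisecantEquation ρ k l) L := by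
  constructor
  · rintro ⟨g, hg0, hg, h⟩ ρ k l v hv w hw hvw
    rw [eval_trisecantEquation]
    set p := LineIn.pluecker v w
    have hdvd : ∀ k, ∃ q, binaryForm 5 (C.dualForms p k) = g * binaryForm 2 q := by
      intro k
      have hk : dualOfVec (dualPluecker p k) ∈ L.1.dualAnnihilator := by
        rw [Submodule.mem_dualAnnihilator]
        intro x hx
        rw [← L.span_pair_eq hv hw hvw, Submodule.mem_span_pair] at hx
        obtain ⟨s, t, rfl⟩ := hx
        rw [map_add, map_smul, map_smul, dualOfVec_apply, dualOfVec_apply,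
          (dualPluecker_mul_eq_zero v w k).1, (dualPluecker_mul_eq_zero v w k).2]
        simp
      have h1 := h _ hk
      rw [restrict_eq, restrictCoeffs_dualOfVec] at h1
      obtain ⟨q, hq, hq'⟩ := (binaryForm_isHomogeneous (C.dualForms p k)).exists_eq_mul_of_dvd
        (k := 3) (m := 2) hg h1
      obtain ⟨q, rfl⟩ := hq.exists_eq_binaryForm
      exact ⟨q, hq'⟩
    obtain ⟨q, hq⟩ := hdvd k
    obtain ⟨q', hq'⟩ := hdvd l
    obtain ⟨a, b, hab, hrel⟩ : ∃ a b : Fin 3 → ℂ, Sum.elim a b ≠ 0 ∧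
        binaryForm 2 a * binaryForm 5 (C.dualForms p k) +
          binaryForm 2 b * binaryForm 5 (C.dualForms p l) = 0 := by
      -- For quintics `g q` and `g q'` the relation has coefficients `q'` and `-q`; if both quintics
      -- vanish, any coefficients do.
      by_cases h0 : q = 0 ∧ q' = 0
      · refine ⟨fun _ => 1, fun _ => 1, fun h => by simpa using congrFun h (Sum.inl 0), ?_⟩
        rw [hq, hq', h0.1, h0.2]
        simp
      · refine ⟨q', (-1 : ℂ) • q, fun h => h0 ⟨?_, ?_⟩, ?_⟩
        · funext i; simpa using congrFun h (Sum.inr i)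
        · funext i; simpa using congrFun h (Sum.inl i)
        · rw [hq, hq', binaryForm_smul]
          simp
          ring
    refine Matrix.exists_mulVec_eq_zero_iff.1 ⟨Sum.elim a b, hab, ?_⟩
    rw [← Matrix.mulVec_mulVec]
    have : (sylvesterMatrix (C.dualForms p k) (C.dualForms p l)).mulVec (Sum.elim a b) = 0 := by
      funext e
      rw [sylvesterMatrix_mulVec, hrel, map_zero, Pi.zero_apply]
    rw [this, Matrix.mulVec_zero]
  · intro h
    obtain ⟨v, w, hv, hw, hvw⟩ := L.exists_basis
    set p := LineIn.pluecker v w with hp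
    obtain ⟨k, l, hkl⟩ := exists_dualPluecker_rows_linearIndependent hvw
    have hker : ¬ Function.Injective
        (sylvesterMatrix (C.dualForms p k) (C.dualForms p l)).mulVec := by
      intro hinj
      obtain ⟨φ, hφ⟩ := LinearMap.exists_leftInverse_of_injective
        (Matrix.toLin' (sylvesterMatrix (C.dualForms p k) (C.dualForms p l)))
        (LinearMap.ker_eq_bot.2 hinj)
      obtain ⟨ρ, rfl⟩ := (Matrix.toLin' (R := ℂ)).surjective φ
      have hρ : ρ * sylvesterMatrix (C.dualForms p k) (C.dualForms p l) = 1 := by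
        rw [← Matrix.toLin'_mul, ← Matrix.toLin'_one] at hφ
        exact Matrix.toLin'.injective hφ
      have h1 := h ρ k l v hv w hw hvw
      rw [eval_trisecantEquation, ← hp, hρ, Matrix.det_one] at h1
      exact one_ne_zero h1
    obtain ⟨ab, hab0, hab⟩ : ∃ ab, ab ≠ 0 ∧
        (sylvesterMatrix (C.dualForms p k) (C.dualForms p l)).mulVec ab = 0 := by
      by_contra! hne
      exact hker ((injective_iff_map_eq_zero
        (Matrix.mulVecLin (sylvesterMatrix (C.dualForms p k) (C.dualForms p l)))).2
          fun x hx => by_contra fun hx0 => hne x hx0 hx)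
    obtain ⟨a, b, rfl⟩ : ∃ a b, ab = Sum.elim a b :=
      ⟨ab ∘ Sum.inl, ab ∘ Sum.inr, (Sum.elim_comp_inl_inr ab).symm⟩
    have hrel : binaryForm 2 a * binaryForm 5 (C.dualForms p k) +
          binaryForm 2 b * binaryForm 5 (C.dualForms p l) = 0 := by
      refine eq_zero_of_forall_eval_eq_zero (d := 7)
        (((binaryForm_isHomogeneous a).mul (binaryForm_isHomogeneous _)).add
          ((binaryForm_isHomogeneous b).mul (binaryForm_isHomogeneous _))) fun e => ?_
      rw [← sylvesterMatrix_mulVec, hab, Pi.zero_apply]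
    have hspan := span_dualOfVec_eq hv hw hvw hkl (dualPluecker_mul_eq_zero v w k).1
      (dualPluecker_mul_eq_zero v w k).2 (dualPluecker_mul_eq_zero v w l).1
      (dualPluecker_mul_eq_zero v w l).2
    have hadd : ∀ (s t : ℂ) (ℓ ℓ' : Module.Dual ℂ (Fin 4 → ℂ)), C.restrict (s • ℓ + t • ℓ') =
        s • C.restrict ℓ + t • C.restrict ℓ' := by
      intro s t ℓ ℓ'
      simp only [restrict, LinearMap.add_apply, LinearMap.smul_apply, smul_eq_mul, map_add,
        map_mul, add_mul, Finset.sum_add_distrib, smul_eq_C_mul, Finset.mul_sum, mul_assoc]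
    have hli : LinearIndependent ℂ ![binaryForm 5 (C.dualForms p k),
        binaryForm 5 (C.dualForms p l)] := by
      rw [LinearIndependent.pair_iff] at hkl ⊢
      intro s t hst
      rw [← restrictCoeffs_dualOfVec, ← restrictCoeffs_dualOfVec, ← restrict_eq, ← restrict_eq,
        ← hadd] at hst
      have h0 : s • dualOfVec (dualPluecker p k) + t • dualOfVec (dualPluecker p l) = 0 := by
        by_contra hne
        exact C.restrict_ne_zero hne hst
      refine hkl s t (funext fun i => ?_)
      have := LinearMap.congr_fun h0 (Pi.single i 1)
      simpa [dualOfVec_single] using this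
    obtain ⟨g, hg0, hg, hgk, hgl⟩ := exists_cubic_dvd_of_relation (binaryForm_isHomogeneous _) hli
      (binaryForm_isHomogeneous a) (binaryForm_isHomogeneous b) (by
        by_contra! h0
        apply hab0
        rw [binaryForm_eq_zero_iff.1 h0.1, binaryForm_eq_zero_iff.1 h0.2]
        exact Sum.elim_zero_zero) hrel
    refine ⟨g, hg0, hg, fun ℓ hℓ => ?_⟩
    rw [← hspan, Submodule.mem_span_pair] at hℓ
    obtain ⟨s, t, rfl⟩ := hℓ
    rw [hadd, restrict_eq, restrict_eq, restrictCoeffs_dualOfVec, restrictCoeffs_dualOfVec]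
    exact dvd_add (dvd_smul_of_dvd _ hgk) (dvd_smul_of_dvd _ hgl)

theorem isClosed_secantLines : IsClosed (C.secantLines 3) := by
  have h : C.secantLines 3 =
      ⋂ ρ, ⋂ k, ⋂ l, {L | LineIn.Vanishes (C.trisecantEquation ρ k l) L} := by
    ext L
    simp only [Set.mem_iInter]
    exact C.isSecant_three_iff_vanishes L
  rw [h]
  exact isClosed_iInter fun ρ => isClosed_iInter fun k => isClosed_iInter fun l =>
    LineIn.isClosed_vanishes (C.isHomogeneous_trisecantEquation ρ k l)

end SmoothRationalCurve

end

noncomputable section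

/-! ### Curves all of whose trisecant lines are four-secant -/

/-- The linear form `∑ₖ aₖ xₖ` on `ℂ²`. -/
def rowForm (a : Fin 2 → ℂ) : MvPolynomial (Fin 2) ℂ := C (a 0) * X 0 + C (a 1) * X 1

theorem rowForm_eq (a : Fin 2 → ℂ) : rowForm a = linForm ![-a 1, a 0] := by
  simp [rowForm, linForm]

theorem rowForm_isHomogeneous (a : Fin 2 → ℂ) : (rowForm a).IsHomogeneous 1 :=
  (isHomogeneous_C_mul_X _ _).add (isHomogeneous_C_mul_X _ _)

/-- The quintic form `∑ⱼ Gⱼ Mⱼ`, where `Mⱼ` is the linear form given by row `j` of `M`. -/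
def pencilForm (G : Fin 2 → Fin 5 → ℂ) : Matrix (Fin 2) (Fin 2) ℂ →ₗ[ℂ] MvPolynomial (Fin 2) ℂ where
  toFun M := binaryForm 4 (G 0) * rowForm (M 0) + binaryForm 4 (G 1) * rowForm (M 1)
  map_add' M N := by
    simp only [rowForm, Matrix.add_apply, map_add]; ring
  map_smul' t M := by
    simp only [rowForm, Matrix.smul_apply, smul_eq_mul, map_mul, smul_eq_C_mul, RingHom.id_apply]
    ring

theorem pencilForm_apply (G : Fin 2 → Fin 5 → ℂ) (M : Matrix (Fin 2) (Fin 2) ℂ) :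
    pencilForm G M = binaryForm 4 (G 0) * rowForm (M 0) + binaryForm 4 (G 1) * rowForm (M 1) := rfl

theorem pencilForm_isHomogeneous (G : Fin 2 → Fin 5 → ℂ) (M : Matrix (Fin 2) (Fin 2) ℂ) :
    (pencilForm G M).IsHomogeneous 5 :=
  ((binaryForm_isHomogeneous (d := 4) _).mul (rowForm_isHomogeneous _)).add
    ((binaryForm_isHomogeneous (d := 4) _).mul (rowForm_isHomogeneous _))

theorem eval_pencilForm (G : Fin 2 → Fin 5 → ℂ) (M : Matrix (Fin 2) (Fin 2) ℂ) (s : Fin 2 → ℂ) :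
    eval s (pencilForm G M) =
      ∑ j, ∑ k, M j k * (eval s (binaryForm 4 (G j)) * s k) := by
  simp [pencilForm_apply, rowForm, Fin.sum_univ_two]
  ring

namespace SmoothRationalCurve

variable (C : SmoothRationalCurve 3 5)

/-- Restriction of linear forms to the curve, as a linear map. -/
def restrictLinear : Module.Dual ℂ (Fin 4 → ℂ) →ₗ[ℂ] MvPolynomial (Fin 2) ℂ where
  toFun := C.restrict
  map_add' ℓ ℓ' := by
    simp only [restrict, LinearMap.add_apply, map_add, add_mul, Finset.sum_add_distrib]
  map_smul' t ℓ := by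
    simp only [restrict, LinearMap.smul_apply, smul_eq_mul, map_mul, smul_eq_C_mul,
      RingHom.id_apply, Finset.mul_sum, mul_assoc]

theorem restrictLinear_apply (ℓ : Module.Dual ℂ (Fin 4 → ℂ)) :
    C.restrictLinear ℓ = C.restrict ℓ := rfl

theorem restrictLinear_injective : Function.Injective C.restrictLinear := by
  rw [injective_iff_map_eq_zero]
  intro ℓ h
  by_contra hℓ
  exact C.restrict_ne_zero hℓ h

/-- A quintic form killed by the kernel of the span map is the restriction of a linear form. -/
theorem exists_restrict_eq {f : Fin 6 → ℂ}
    (hf : ∀ ν, C.spanMap ν = 0 → ∑ l, f l * ν l = 0) : ∃ ℓ, C.restrict ℓ = binaryForm 5 f := by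
  let φ : Module.Dual ℂ (Fin 6 → ℂ) := ∑ l, f l • LinearMap.proj l
  have hφ : ∀ ν, φ ν = ∑ l, f l * ν l := fun ν => by simp [φ]
  have hmem : φ ∈ LinearMap.range C.spanMap.dualMap := by
    rw [LinearMap.range_dualMap_eq_dualAnnihilator_ker, Submodule.mem_dualAnnihilator]
    intro ν hν
    rw [hφ, hf ν hν]
  obtain ⟨ℓ, hℓ⟩ := hmem
  refine ⟨ℓ, ?_⟩
  rw [restrict_eq]
  congr 1
  funext l
  have h1 := LinearMap.congr_fun hℓ (Pi.single l 1)
  rw [LinearMap.dualMap_apply, ← sum_restrictCoeffs_mul, hφ] at h1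
  simpa [Pi.single_apply] using h1

/-- The span of `G` has dimension four and its image at most two, so it contains the whole
two-dimensional kernel, and its image is exactly `L`. -/
theorem ker_le_annihilator_of_isSecant_four {L : LineIn 3} (hL : C.IsSecant 4 L) :
    ∃ G : Fin 5 → ℂ, G ≠ 0 ∧ LinearMap.ker C.spanMap ≤ annihilator (k := 4) 1 G ∧
      L.1 = (annihilator (k := 4) 1 G).map C.spanMap := by
  obtain ⟨G, hG, hle⟩ := (C.isSecant_iff (k := 4) (m := 1) rfl L).1 hL
  have h1 := C.two_le_finrank_of_annihilator_le hG hle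
  have h2 : LinearMap.ker C.spanMap ⊓ annihilator (k := 4) 1 G = LinearMap.ker C.spanMap :=
    Submodule.eq_of_le_of_finrank_le inf_le_left (by rw [C.finrank_ker_spanMap]; exact h1)
  refine ⟨G, hG, inf_eq_left.1 h2, ?_⟩
  refine (Submodule.eq_of_le_of_finrank_le hle ?_).symm
  have h3 := finrank_map_add_finrank_ker_inf C.spanMap (annihilator (k := 4) 1 G)
  rw [finrank_annihilator (k := 4) rfl hG, h2, C.finrank_ker_spanMap] at h3
  rw [L.2]
  omega

/-- In a nontrivial relation `G₀ a + G₁ b = 0` with linear `a`, `b`, proportional `a` and `b` would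
give `L 0 = L 1`. Otherwise `G₀` and `G₁` share a cubic factor `c`, and the kernel, which kills
their multiples, lies in the annihilator of `c`; but that intersection has dimension at most one. -/
theorem pencilForm_injective {G : Fin 2 → Fin 5 → ℂ} {L : Fin 2 → LineIn 3} (hL : L 0 ≠ L 1)
    (hG : ∀ j, G j ≠ 0) (hK : ∀ j, LinearMap.ker C.spanMap ≤ annihilator (k := 4) 1 (G j))
    (hLG : ∀ j, (L j).1 = (annihilator (k := 4) 1 (G j)).map C.spanMap) :
    Function.Injective (pencilForm G) := by
  rw [injective_iff_map_eq_zero]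
  intro M hM
  rw [pencilForm_apply, rowForm_eq, rowForm_eq] at hM
  set x : Fin 2 → ℂ := ![-M 0 1, M 0 0] with hxdef
  set y : Fin 2 → ℂ := ![-M 1 1, M 1 0] with hydef
  have hG' : ∀ j, binaryForm 4 (G j) ≠ 0 := fun j h => hG j (binaryForm_eq_zero_iff.1 h)
  have hlin0 : linForm 0 = 0 := by simp [linForm]
  have hxy0 : x = 0 → y = 0 := by
    intro h
    rw [h, hlin0, mul_zero, zero_add] at hM
    by_contra hy
    exact linForm_ne_zero hy ((mul_eq_zero.1 hM).resolve_left (hG' 1))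
  by_cases hx : x = 0
  · have hy := hxy0 hx
    have h1 := congrFun hx 0
    have h2 := congrFun hx 1
    have h3 := congrFun hy 0
    have h4 := congrFun hy 1
    simp [hxdef, hydef] at h1 h2 h3 h4
    ext i j
    fin_cases i <;> fin_cases j <;> simp [h1, h2, h3, h4]
  exfalso
  have hxx : eval x (linForm x) = 0 := by rw [eval_linForm]; ring
  by_cases hyx : eval x (linForm y) = 0
  · obtain ⟨c, -, hc⟩ := exists_eq_linForm_mul (d := 0) (linForm_isHomogeneous y) hx hyx
    rw [hc] at hM
    have h1 : linForm x * (binaryForm 4 (G 0) + c * binaryForm 4 (G 1)) = 0 := by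
      linear_combination hM
    have h2 := (mul_eq_zero.1 h1).resolve_left (linForm_ne_zero hx)
    have hle := annihilator_le_of_dvd (k := 4) (m := 1) (k' := 4) (m' := 1) rfl rfl
      (g := G 1) (g' := G 0) ⟨-c, by linear_combination h2⟩
    apply hL
    apply Subtype.ext
    symm
    refine Submodule.eq_of_le_of_finrank_le ?_ ?_
    · rw [hLG 1, hLG 0]
      exact Submodule.map_mono hle
    · rw [(L 0).2, (L 1).2]
  · have h1 := congrArg (eval x) hM
    rw [map_add, map_mul, map_mul, hxx, mul_zero, zero_add, map_zero] at h1
    obtain ⟨c, hc, hGc⟩ := exists_eq_linForm_mul (d := 3) (binaryForm_isHomogeneous (G 1)) hx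
      ((mul_eq_zero.1 h1).resolve_right hyx)
    obtain ⟨c, rfl⟩ := hc.exists_eq_binaryForm
    have h2 : linForm x * (binaryForm 4 (G 0) + binaryForm 3 c * linForm y) = 0 := by
      rw [hGc] at hM
      linear_combination hM
    have h3 := (mul_eq_zero.1 h2).resolve_left (linForm_ne_zero hx)
    have hc0 : c ≠ 0 := by
      rintro rfl
      rw [binaryForm_zero, mul_zero] at hGc
      exact hG' 1 hGc
    have hKc : LinearMap.ker C.spanMap ≤ annihilator (k := 3) 2 c := by
      intro ν hν
      rw [mem_annihilator_iff (k := 3) (m := 2) rfl]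
      intro f hf
      obtain ⟨h, hh, hfh⟩ := (binaryForm_isHomogeneous (d := 5) f).exists_eq_mul_of_dvd
        (k := 3) (m := 2) (binaryForm_isHomogeneous (d := 3) c) hf
      -- With this `α`, `h - α (linForm y)²` vanishes at `x` and equals `linForm x * h₁`. Hence `c h
      -- = G₁ h₁ - α G₀ linForm y`, a sum of multiples of `G₁` and `G₀`.
      set α : ℂ := eval x h / (eval x (linForm y)) ^ 2 with hα
      have hdiff : (h - MvPolynomial.C α * (linForm y * linForm y)).IsHomogeneous (1 + 1) :=
        hh.sub (((linForm_isHomogeneous y).mul (linForm_isHomogeneous y)).C_mul α)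
      obtain ⟨h₁, hh₁, hdh⟩ := exists_eq_linForm_mul hdiff hx (by
        rw [map_sub, map_mul, map_mul, eval_C, hα]
        field_simp
        ring)
      obtain ⟨f₁, hf₁⟩ := ((binaryForm_isHomogeneous (d := 4) (G 1)).mul
        hh₁).exists_eq_binaryForm
      obtain ⟨f₂, hf₂⟩ := (((binaryForm_isHomogeneous (d := 4) (G 0)).mul
        (linForm_isHomogeneous y)).C_mul (-α)).exists_eq_binaryForm
      have hff : f = f₁ + f₂ := by
        apply binaryForm_injective 5
        rw [binaryForm_add]
        have e1 : binaryForm 5 f₁ = binaryForm 4 (G 1) * h₁ := hf₁.symm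
        have e2 : binaryForm 5 f₂ = MvPolynomial.C (-α) * (binaryForm 4 (G 0) * linForm y) :=
          hf₂.symm
        rw [e1, e2, hfh, hGc, C_neg]
        linear_combination binaryForm 3 c * hdh + MvPolynomial.C α * linForm y * h3
      have s1 := (mem_annihilator_iff (k := 4) (m := 1) rfl).1 (hK 1 hν) f₁ ⟨_, hf₁.symm⟩
      have s2 := (mem_annihilator_iff (k := 4) (m := 1) rfl).1 (hK 0 hν) f₂
        ⟨MvPolynomial.C (-α) * linForm y, by
          refine hf₂.symm.trans ?_
          ring⟩
      rw [hff]
      simp only [Pi.add_apply, add_mul, Finset.sum_add_distrib, s1, s2, add_zero]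
    have h4 := C.isSeparating_ker_spanMap.finrank_inf_annihilator_le hc0
    rw [inf_eq_left.2 hKc, C.finrank_ker_spanMap] at h4
    omega

/-- If all trisecant lines are four-secant, the curve is the image of `s ↦ A (G(s) sᵀ)` for a
pencil `G` of quartic forms and a linear isomorphism `A`. -/
theorem exists_segre_parametrization
    (h : ∀ L : LineIn 3, C.IsSecant 3 L → C.IsSecant 4 L) :
    ∃ (G : Fin 2 → Fin 5 → ℂ) (A : Matrix (Fin 2) (Fin 2) ℂ ≃ₗ[ℂ] (Fin 4 → ℂ)),
      ∀ s : Fin 2 → ℂ, A (Matrix.vecMulVec (fun j => eval s (binaryForm 4 (G j))) s) =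
        evalForms C.form s := by
  obtain ⟨L₀, hL₀, L₁, hL₁, hne⟩ := C.infinite_secantLines.nontrivial
  obtain ⟨G₀, hG₀, hK₀, hLG₀⟩ := C.ker_le_annihilator_of_isSecant_four (h L₀ hL₀)
  obtain ⟨G₁, hG₁, hK₁, hLG₁⟩ := C.ker_le_annihilator_of_isSecant_four (h L₁ hL₁)
  set G : Fin 2 → Fin 5 → ℂ := ![G₀, G₁]
  have hinj : Function.Injective (pencilForm G) := by
    refine C.pencilForm_injective (G := G) (L := ![L₀, L₁]) hne ?_ ?_ ?_ <;>
      intro j <;> fin_cases j <;> assumption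
  have hK : ∀ j, LinearMap.ker C.spanMap ≤ annihilator (k := 4) 1 (G j) := by
    intro j; fin_cases j <;> assumption
  have hex : ∀ M, ∃ ℓ, C.restrictLinear ℓ = pencilForm G M := by
    intro M
    obtain ⟨f, hf⟩ := (pencilForm_isHomogeneous G M).exists_eq_binaryForm
    rw [hf]
    refine C.exists_restrict_eq fun ν hν => ?_
    have hf' := hf
    rw [pencilForm_apply] at hf'
    obtain ⟨f₀, hf₀⟩ := ((binaryForm_isHomogeneous (d := 4) (G 0)).mul
      (rowForm_isHomogeneous (M 0))).exists_eq_binaryForm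
    obtain ⟨f₁, hf₁⟩ := ((binaryForm_isHomogeneous (d := 4) (G 1)).mul
      (rowForm_isHomogeneous (M 1))).exists_eq_binaryForm
    have hff : f = f₀ + f₁ := by
      apply binaryForm_injective 5
      rw [binaryForm_add, ← hf', hf₀, hf₁]
    have s0 := (mem_annihilator_iff (k := 4) (m := 1) rfl).1 (hK 0 hν) f₀ ⟨_, hf₀.symm⟩
    have s1 := (mem_annihilator_iff (k := 4) (m := 1) rfl).1 (hK 1 hν) f₁ ⟨_, hf₁.symm⟩
    rw [hff]
    simp only [Pi.add_apply, add_mul, Finset.sum_add_distrib, s0, s1, add_zero]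
  -- Both spaces have dimension four: the `2 × 2` matrices on one side, the linear forms on `ℂ⁴` on
  -- the other.
  have hrange : LinearMap.range (pencilForm G) = LinearMap.range C.restrictLinear := by
    apply Submodule.eq_of_le_of_finrank_eq
    · rintro _ ⟨M, rfl⟩
      obtain ⟨ℓ, hℓ⟩ := hex M
      exact ⟨ℓ, hℓ⟩
    · rw [LinearMap.finrank_range_of_inj hinj,
        LinearMap.finrank_range_of_inj C.restrictLinear_injective, Subspace.dual_finrank_eq]
      simp [Module.finrank_matrix]
  have hN : ∀ i : Fin 4, ∃ N, pencilForm G N = C.form i := by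
    intro i
    have hmem : C.form i ∈ LinearMap.range C.restrictLinear := by
      refine ⟨LinearMap.proj i, ?_⟩
      rw [restrictLinear_apply]
      simp [restrict, Pi.single_apply, apply_ite MvPolynomial.C, ite_mul]
    rw [← hrange] at hmem
    exact hmem
  choose N hN using hN
  -- The matrix `N i` writes the coordinate form `i` as a combination of the products `Gⱼ sₖ`, so
  -- pairing with the `N i` takes `G(s) sᵀ` to the point of the curve. It is injective because the
  -- `N i` span all matrices.
  let A : Matrix (Fin 2) (Fin 2) ℂ →ₗ[ℂ] (Fin 4 → ℂ) :=
    { toFun := fun M i => ∑ j, ∑ k, N i j k * M j k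
      map_add' := fun M M' => by
        ext i
        simp only [Matrix.add_apply, mul_add, Finset.sum_add_distrib, Pi.add_apply]
      map_smul' := fun t M => by
        ext i
        simp only [Matrix.smul_apply, smul_eq_mul, RingHom.id_apply, Pi.smul_apply,
          Finset.mul_sum, mul_left_comm] }
  have hA : ∀ M i, A M i = ∑ j, ∑ k, N i j k * M j k := fun M i => rfl
  have hspan : ∀ M, ∃ c : Fin 4 → ℂ, M = ∑ i, c i • N i := by
    intro M
    obtain ⟨ℓ, hℓ⟩ := hex M
    refine ⟨fun i => ℓ (Pi.single i 1), hinj ?_⟩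
    rw [← hℓ, map_sum, restrictLinear_apply, restrict]
    refine Finset.sum_congr rfl fun i _ => ?_
    rw [map_smul, smul_eq_C_mul]
    exact congrArg _ (hN i).symm
  have hAinj : Function.Injective A := by
    rw [injective_iff_map_eq_zero]
    intro M hM
    ext j k
    obtain ⟨c, hc⟩ := hspan (Matrix.single j k 1)
    have h1 : ∑ j', ∑ k', Matrix.single j k (1 : ℂ) j' k' * M j' k' = ∑ i, c i * A M i := by
      rw [hc]
      simp only [hA, Matrix.sum_apply, Matrix.smul_apply, smul_eq_mul, Fin.sum_univ_two,
        Fin.sum_univ_four]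
      ring
    rw [hM] at h1
    fin_cases j <;> fin_cases k <;>
      simpa [Fin.sum_univ_two, Matrix.single_apply] using h1
  refine ⟨G, LinearEquiv.ofBijective A ⟨hAinj,
    (LinearMap.injective_iff_surjective_of_finrank_eq_finrank
      (by simp [Module.finrank_matrix])).1 hAinj⟩, fun s => ?_⟩
  funext i
  change A _ i = eval s (C.form i)
  rw [← hN i, eval_pencilForm, hA]
  rfl

end SmoothRationalCurve

end

noncomputable section

/-! ### Divisors of type `(1, 4)` on a smooth quadric -/

section Quadric

variable (A : Matrix (Fin 2) (Fin 2) ℂ ≃ₗ[ℂ] (Fin 4 → ℂ))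

/-- The matrix entries in the coordinates given by `A`. -/
def entryForm (i j : Fin 2) : MvPolynomial (Fin 4) ℂ :=
  ∑ k, C (A.symm (Pi.single k 1) i j) * X k

/-- The equation of the image of the Segre surface under `A`. -/
def segreQuadric : MvPolynomial (Fin 4) ℂ :=
  entryForm A 0 0 * entryForm A 1 1 - entryForm A 0 1 * entryForm A 1 0

theorem symm_apply_eq_sum (x : Fin 4 → ℂ) (i j : Fin 2) :
    A.symm x i j = ∑ k, A.symm (Pi.single k 1) i j * x k := by
  have h := Module.Dual.apply_eq_sum
    ((LinearMap.proj j ∘ₗ LinearMap.proj i : (Fin 2 → Fin 2 → ℂ) →ₗ[ℂ] ℂ) ∘ₗ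
      (A.symm.toLinearMap : (Fin 4 → ℂ) →ₗ[ℂ] (Fin 2 → Fin 2 → ℂ))) x
  exact h

theorem eval_entryForm (x : Fin 4 → ℂ) (i j : Fin 2) :
    eval x (entryForm A i j) = A.symm x i j := by
  rw [symm_apply_eq_sum]
  simp [entryForm]

theorem eval_segreQuadric (x : Fin 4 → ℂ) : eval x (segreQuadric A) = (A.symm x).det := by
  simp [segreQuadric, eval_entryForm, Matrix.det_fin_two]

theorem pderiv_entryForm (k : Fin 4) (i j : Fin 2) :
    pderiv k (entryForm A i j) = C (A.symm (Pi.single k 1) i j) := by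
  simp only [entryForm, map_sum, pderiv_C_mul, pderiv_X]
  rw [Finset.sum_eq_single k]
  · simp
  · intro l _ hl
    simp [hl]
  · simp

/-- The partial derivatives at `x` are values of the polar form of the determinant at `A.symm x`;
the polar form is nondegenerate, as the four matrix units show. -/
theorem isSmoothQuadric_segreQuadric : IsSmoothQuadric (segreQuadric A) := by
  have hlin : ∀ i j, (entryForm A i j).IsHomogeneous 1 := fun i j =>
    IsHomogeneous.sum _ _ _ fun k _ => isHomogeneous_C_mul_X _ _
  refine ⟨((hlin 0 0).mul (hlin 1 1)).sub ((hlin 0 1).mul (hlin 1 0)), fun x hx _ => ?_⟩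
  by_contra! h
  apply hx
  set M := A.symm x with hM
  have hk : ∀ k, A.symm (Pi.single k 1) 0 0 * M 1 1 + M 0 0 * A.symm (Pi.single k 1) 1 1 -
      (A.symm (Pi.single k 1) 0 1 * M 1 0 + M 0 1 * A.symm (Pi.single k 1) 1 0) = 0 := by
    intro k
    have := h k
    simp [segreQuadric, pderiv_entryForm, eval_entryForm] at this
    linear_combination this
  have hpolar : ∀ N : Matrix (Fin 2) (Fin 2) ℂ,
      N 0 0 * M 1 1 + M 0 0 * N 1 1 - (N 0 1 * M 1 0 + M 0 1 * N 1 0) = 0 := by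
    intro N
    have hN : ∀ i j, N i j = ∑ k, A.symm (Pi.single k 1) i j * A N k := fun i j => by
      rw [← symm_apply_eq_sum, A.symm_apply_apply]
    rw [hN 0 0, hN 1 1, hN 0 1, hN 1 0]
    simp only [Fin.sum_univ_four]
    linear_combination A N 0 * hk 0 + A N 1 * hk 1 + A N 2 * hk 2 + A N 3 * hk 3
  have hM0 : M = 0 := by
    have h00 := hpolar !![0, 0; 0, 1]
    have h01 := hpolar !![0, 0; 1, 0]
    have h10 := hpolar !![0, 1; 0, 0]
    have h11 := hpolar !![1, 0; 0, 0]
    simp at h00 h01 h10 h11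
    ext i j
    fin_cases i <;> fin_cases j <;> simp [h00, h01, h10, h11]
  rw [← A.apply_symm_apply x, ← hM, hM0, map_zero]

theorem isSegreCoordinates_segreQuadric : IsSegreCoordinates (segreQuadric A) A := by
  intro M
  rw [eval_segreQuadric, A.symm_apply_apply]

end Quadric

section Graph

variable (G : Fin 2 → Fin 5 → ℂ)

/-- The quartic form `Gⱼ` in the second set of variables. -/
def secondForm (j : Fin 2) : MvPolynomial (Fin 2 ⊕ Fin 2) ℂ :=
  ∑ l : Fin 5, C (G j l) * (X (Sum.inr 0) ^ (l : ℕ) * X (Sum.inr 1) ^ (4 - (l : ℕ)))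

/-- The form `x₀ G₁(y) - x₁ G₀(y)` of bidegree `(1, 4)`. -/
def graphForm : MvPolynomial (Fin 2 ⊕ Fin 2) ℂ :=
  X (Sum.inl 0) * secondForm G 1 - X (Sum.inl 1) * secondForm G 0

theorem eval_secondForm (j : Fin 2) (z : Fin 2 ⊕ Fin 2 → ℂ) :
    eval z (secondForm G j) = eval (z ∘ Sum.inr) (binaryForm 4 (G j)) := by
  rw [eval_binaryForm]
  simp [secondForm]

theorem eval_graphForm (x y : Fin 2 → ℂ) :
    eval (Sum.elim x y) (graphForm G) =
      x 0 * eval y (binaryForm 4 (G 1)) - x 1 * eval y (binaryForm 4 (G 0)) := by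
  simp [graphForm, eval_secondForm]

theorem pderiv_secondForm (i j : Fin 2) : pderiv (Sum.inl i) (secondForm G j) = 0 := by
  simp only [secondForm, map_sum, pderiv_mul, pderiv_pow]
  refine Finset.sum_eq_zero fun l _ => ?_
  rw [pderiv_X_of_ne (by simp), pderiv_X_of_ne (by simp)]
  simp

theorem isWeightedHomogeneous_secondForm (a b : ℕ) (j : Fin 2) :
    (secondForm G j).IsWeightedHomogeneous
      (Sum.elim (fun _ => a) (fun _ => b) : Fin 2 ⊕ Fin 2 → ℕ) (4 * b) := by
  refine IsWeightedHomogeneous.sum _ _ _ fun l _ => ?_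
  have h := (((isWeightedHomogeneous_X ℂ
    (Sum.elim (fun _ => a) (fun _ => b) : Fin 2 ⊕ Fin 2 → ℕ) (Sum.inr 0)).pow (l : ℕ)).mul
    ((isWeightedHomogeneous_X ℂ
    (Sum.elim (fun _ => a) (fun _ => b) : Fin 2 ⊕ Fin 2 → ℕ) (Sum.inr 1)).pow (4 - (l : ℕ))))
  have h2 := (isWeightedHomogeneous_C
    (Sum.elim (fun _ => a) (fun _ => b) : Fin 2 ⊕ Fin 2 → ℕ) (G j l)).mul h
  convert h2 using 1
  simp only [Sum.elim_inr, smul_eq_mul, zero_add, ← add_mul]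
  congr 1
  have := l.2
  omega

theorem isBihomogeneous_graphForm : IsBihomogeneous (graphForm G) 1 4 := by
  -- Arbitrary weights `a`, `b` treat both gradings at once.
  have key : ∀ a b, (graphForm G).IsWeightedHomogeneous
      (Sum.elim (fun _ => a) (fun _ => b) : Fin 2 ⊕ Fin 2 → ℕ) (a + 4 * b) := by
    intro a b
    have h : ∀ i j, (X (Sum.inl i) * secondForm G j).IsWeightedHomogeneous
        (Sum.elim (fun _ => a) (fun _ => b) : Fin 2 ⊕ Fin 2 → ℕ) (a + 4 * b) := fun i j =>
      (isWeightedHomogeneous_X ℂ _ (Sum.inl i)).mul (isWeightedHomogeneous_secondForm G a b j)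
    exact (weightedHomogeneousSubmodule ℂ _ _).sub_mem (h 0 1) (h 1 0)
  exact ⟨key 1 0, key 0 1⟩

/-- A polynomial without zeros outside `y = 0` is constant. -/
theorem isUnit_of_forall_eval_ne_zero {p : MvPolynomial (Fin 2 ⊕ Fin 2) ℂ}
    (hp : ∀ x y : Fin 2 → ℂ, y ≠ 0 → eval (Sum.elim x y) p ≠ 0) : IsUnit p := by
  have he : (![1, 0] : Fin 2 → ℂ) ≠ 0 := fun h => by simpa using congrFun h 0
  set c := eval (Sum.elim (0 : Fin 2 → ℂ) ![1, 0]) p with hc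
  have hc0 : c ≠ 0 := hp _ _ he
  have hconst : ∀ x y : Fin 2 → ℂ, y 1 ≠ 0 → eval (Sum.elim x y) p = c := by
    intro x y hy
    -- The line from `(x, y)` to `(0, (1, 0))` avoids `y = 0`: the second coordinate of its `y`-part
    -- is `(1 - t) y₁`, and at `t = 1` the `y`-part is `(1, 0)`. So `p` restricts to a polynomial
    -- without roots, which is constant.
    let line : Fin 2 ⊕ Fin 2 → Polynomial ℂ := fun i =>
      Polynomial.C (Sum.elim x y i) + Polynomial.X *
        Polynomial.C (Sum.elim (0 : Fin 2 → ℂ) ![1, 0] i - Sum.elim x y i)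
    have hline : ∀ t, (aeval line p).eval t = eval (fun i => (line i).eval t) p := by
      intro t
      rw [← Polynomial.coe_evalRingHom, MvPolynomial.aeval_def, MvPolynomial.hom_eval₂]
      change _ = eval₂ (RingHom.id ℂ) _ p
      congr 1
      ext z
      simp
    have hsplit : ∀ t, (fun i => (line i).eval t) =
        Sum.elim (fun i => (line (Sum.inl i)).eval t) (fun i => (line (Sum.inr i)).eval t) := by
      intro t
      funext i
      rcases i with i | i <;> rfl
    have hne : ∀ t, (aeval line p).eval t ≠ 0 := by
      intro t
      rw [hline, hsplit]
      apply hp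
      intro h0
      have h1 := congrFun h0 1
      have h2 := congrFun h0 0
      simp only [line, Sum.elim_inr, Polynomial.eval_add, Polynomial.eval_mul, Polynomial.eval_C,
        Polynomial.eval_X, Pi.zero_apply, Matrix.cons_val_zero, Matrix.cons_val_one] at h1 h2
      have ht : t = 1 := by
        have : (1 - t) * y 1 = 0 := by linear_combination h1
        have := (mul_eq_zero.1 this).resolve_right hy
        linear_combination -this
      rw [ht] at h2
      exact one_ne_zero (α := ℂ) (by linear_combination h2)
    have hdeg : (aeval line p).degree = 0 := by
      by_contra hd
      obtain ⟨t, ht⟩ := IsAlgClosed.exists_root _ hd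
      exact hne t ht
    rw [Polynomial.eq_C_of_degree_eq_zero hdeg] at hline
    have h0 := hline 0
    have h1 := hline 1
    have e0 : (fun i => (line i).eval 0) = Sum.elim x y := by
      funext i; simp [line]
    have e1 : (fun i => (line i).eval 1) = Sum.elim (0 : Fin 2 → ℂ) ![1, 0] := by
      funext i; simp [line]
    rw [e0, Polynomial.eval_C] at h0
    rw [e1, Polynomial.eval_C] at h1
    rw [← h0, h1]
  have hzero : (p - C c) * X (Sum.inr 1) = 0 := by
    apply MvPolynomial.funext
    intro z
    have hz : z = Sum.elim (z ∘ Sum.inl) (z ∘ Sum.inr) := (Sum.elim_comp_inl_inr z).symm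
    by_cases hy : z (Sum.inr 1) = 0
    · simp [hy]
    · have := hconst (z ∘ Sum.inl) (z ∘ Sum.inr) hy
      rw [← hz] at this
      simp [this]
  have hpc : p = C c := by
    have := (mul_eq_zero.1 hzero).resolve_right (X_ne_zero _)
    exact sub_eq_zero.1 this
  rw [hpc]
  exact (IsUnit.mk0 c hc0).map C

/-- If `p²` divides the form, then at a zero of `p` both `x`-derivatives, `G₁(y)` and `-G₀(y)`,
vanish. As the quartics have no common zero, `p` has no zero with `y ≠ 0` and is a unit. -/
theorem squarefree_graphForm
    (hG : ∀ y : Fin 2 → ℂ, y ≠ 0 → (fun j => eval y (binaryForm 4 (G j))) ≠ 0) :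
    Squarefree (graphForm G) := by
  rintro p ⟨r, hr⟩
  refine isUnit_of_forall_eval_ne_zero fun x y hy hp => hG y hy ?_
  have hder : ∀ i, eval (Sum.elim x y) (pderiv (Sum.inl i) (graphForm G)) = 0 := by
    intro i
    rw [hr]
    simp [hp]
  have h0 := hder 0
  have h1 := hder 1
  simp [graphForm, pderiv_secondForm, eval_secondForm, pderiv_X]
    at h0 h1
  funext j
  fin_cases j
  · exact h1
  · exact h0

end Graph

namespace SmoothRationalCurve

variable (C : SmoothRationalCurve 3 5)

/-- The form `x₀ G₁(y) - x₁ G₀(y)` vanishes exactly when `x` is proportional to `G(y)`, that is,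
when `x yᵀ` is proportional to the matrix of the point of the curve with parameter `y`. -/
theorem isDivisorOfType_of_segre_parametrization {G : Fin 2 → Fin 5 → ℂ}
    {A : Matrix (Fin 2) (Fin 2) ℂ ≃ₗ[ℂ] (Fin 4 → ℂ)}
    (hA : ∀ s : Fin 2 → ℂ, A (Matrix.vecMulVec (fun j => eval s (binaryForm 4 (G j))) s) =
      evalForms C.form s) :
    IsDivisorOfType (segreQuadric A) C.points 1 4 := by
  have hG : ∀ y : Fin 2 → ℂ, y ≠ 0 → (fun j => eval y (binaryForm 4 (G j))) ≠ 0 := by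
    intro y hy h0
    apply C.base_point_free y hy
    rw [← hA y, h0]
    simp
  refine ⟨?_, A, isSegreCoordinates_segreQuadric A, graphForm G, isBihomogeneous_graphForm G,
    squarefree_graphForm G hG, ?_⟩
  · rintro _ ⟨P, rfl⟩
    induction P using Projectivization.ind with
    | h s hs =>
      rw [onPoints_mk]
      obtain ⟨a, ha⟩ := Projectivization.exists_smul_eq_mk_rep ℂ _ (C.base_point_free s hs)
      rw [← ha, eval_segreQuadric, ← hA s, Units.smul_def, map_smul, A.symm_apply_apply,
        Matrix.det_fin_two]
      simp [Matrix.vecMulVec_apply]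
      ring
  · intro x y hx hy hxy
    rw [eval_graphForm]
    constructor
    · intro h
      obtain ⟨t, ht⟩ := exists_smul_eq_of_eval_linForm_eq_zero (y := x) (hG y hy) (by
        rw [eval_linForm]; linear_combination h)
      refine ⟨Projectivization.mk ℂ y hy, ?_⟩
      rw [onPoints_mk, eq_comm, Projectivization.mk_eq_mk_iff']
      refine ⟨t, ?_⟩
      rw [← hA y, ← map_smul, ht, Matrix.smul_vecMulVec]
    · rintro ⟨P, hP⟩
      induction P using Projectivization.ind with
      | h s hs =>
        rw [onPoints_mk, Projectivization.mk_eq_mk_iff'] at hP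
        obtain ⟨a, ha⟩ := hP
        have hmat : a • Matrix.vecMulVec x y =
            Matrix.vecMulVec (fun j => eval s (binaryForm 4 (G j))) s := by
          apply A.injective
          rw [map_smul, ha, hA]
        have hent : ∀ j k, a * (x j * y k) = eval s (binaryForm 4 (G j)) * s k := by
          intro j k
          have := congrFun (congrFun hmat j) k
          simpa [Matrix.vecMulVec_apply] using this
        have ha0 : a ≠ 0 := by
          rintro rfl
          rw [zero_smul] at ha
          exact C.base_point_free s hs ha.symm
        obtain ⟨j₀, hj₀⟩ := Function.ne_iff.1 (hG s hs)
        have hj₀ : eval s (binaryForm 4 (G j₀)) ≠ 0 := hj₀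
        obtain ⟨k₀, hk₀⟩ := Function.ne_iff.1 hy
        have hk₀ : y k₀ ≠ 0 := hk₀
        -- From the rank one identity `a x yᵀ = G(s) sᵀ`, row `j₀` gives `s = β y`. Then `G(s) = β⁴
        -- G(y)`, so that `a x = β⁵ G(y)`.
        set β := a * x j₀ / eval s (binaryForm 4 (G j₀)) with hβ
        have hs' : s = β • y := by
          funext k
          have := hent j₀ k
          rw [Pi.smul_apply, smul_eq_mul, hβ]
          field_simp
          linear_combination -this
        have hhom : ∀ j, eval s (binaryForm 4 (G j)) = β ^ 4 * eval y (binaryForm 4 (G j)) := by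
          intro j
          have := congrFun (evalForms_smul (n := 1) (φ := fun j => binaryForm 4 (G j))
            (fun j => binaryForm_isHomogeneous _) β y) j
          rw [← hs'] at this
          simpa [evalForms] using this
        have hx' : ∀ j, a * x j = β ^ 5 * eval y (binaryForm 4 (G j)) := by
          intro j
          have h1 := hent j k₀
          have h2 : s k₀ = β * y k₀ := congrFun hs' k₀
          rw [hhom, h2] at h1
          apply mul_right_cancel₀ hk₀
          linear_combination h1
        apply (mul_eq_zero.1 (_ : a * _ = 0)).resolve_left ha0
        linear_combination eval y (binaryForm 4 (G 1)) * hx' 0 -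
          eval y (binaryForm 4 (G 0)) * hx' 1

end SmoothRationalCurve

end

theorem mainTheorem12 :
    (∀ C : SmoothRationalCurve 4 5, C.Nondegenerate →
      ∃ L : LineIn 4, C.IsSecant 3 L ∧ (∀ M : LineIn 4, C.IsSecant 3 M → M = L) ∧
        ¬ C.IsSecant 4 L) ∧
    (∀ C : SmoothRationalCurve 3 5,
      IsClosed (C.secantLines 3) ∧ IsIrreducible (C.secantLines 3) ∧
        topologicalKrullDim (C.secantLines 3) = 1) ∧
    (∀ C : SmoothRationalCurve 3 5,
      (∀ L : LineIn 3, C.IsSecant 3 L → C.IsSecant 4 L) →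
        ∃ q : MvPolynomial (Fin 4) ℂ, IsSmoothQuadric q ∧ IsDivisorOfType q C.points 1 4) := by
  refine ⟨fun C hC => C.existsUnique_trisecant hC, fun C => ⟨C.isClosed_secantLines,
    C.isIrreducible_secantLines, C.topologicalKrullDim_secantLines⟩, fun C h => ?_⟩
  obtain ⟨G, A, hA⟩ := C.exists_segre_parametrization h
  exact ⟨segreQuadric A, isSmoothQuadric_segreQuadric A,
    C.isDivisorOfType_of_segre_parametrization hA⟩
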